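/- Let $A, C_0, \alpha, I$ be real numbers. There is a constant $C>0$ depending only on $A, C_0, \alpha, I$ with the following property. Let $T>0$, $s>5/2$ and $2\le p\le\infty$. Let $\phi:\mathbb R\to\mathbb R$ be an admissible weight function with these constants, that is: $\phi$ is positive and locally absolutely continuous; $|\phi'(x)|\le A|\phi(x)|$ for almost every $x$, with $A>0$; and $\phi(x+y)\le C_0\,v(x)\phi(y)$ for all $x,y\in\mathbb R$, with $C_0>0$, where $v:\mathbb R\to[0,\infty)$ is sub-multiplicative ($v(x+y)\le v(x)v(y)$ for all $x,y\in\mathbb R$), $\inf_{x\in\mathbb R}v(x)=\alpha>0$ and $\int_{\mathbb R}v(x)e^{-|x|}\,dx=I<\infty$. Let $u\in C([0,T],H^s(\mathbb R))$ be a real-valued strong solution of the Cauchy problem $$u_t-u_{txx}=\partial_x(2+\partial_x)\big[(2-\partial_x)u\big]^2,\qquad u(0,x)=u_0(x);$$ here the equation is understood at every $t\in(0,T)$ in the sense of tempered distributions in $x$, and each $u(t)$ is identified with its continuous representative (which is $C^2$ because $s>5/2$). Suppose that $u_0\phi$, $(\partial_xu_0)\phi$ and $(\partial_x^2u_0)\phi$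 belong to $L^p(\mathbb R)$. Then $$M:=\sup_{t\in[0,T]}\big(\|u(t)\|_\infty+\|\partial_xu(t)\|_\infty+\|\partial_x^2u(t)\|_\infty\big)<\infty,$$ and for all $t\in[0,T]$, $$\|u(t)\phi\|_p+\|\partial_xu(t)\phi\|_p+\|\partial_x^2u(t)\phi\|_p\le\Big(\|u_0\phi\|_p+\|\partial_xu_0\phi\|_p+\|\partial_x^2u_0\phi\|_p\Big)e^{CMt}.$$ -/

import Mathlib

open MeasureTheory Set
open scoped ENNReal SchwartzMap

/-- `u ∈ C([0,T]; H^s(ℝ))` for a real function `u = u(t,x)`, where `0 ≤ s`: for every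
`t ∈ [0,T]` the function `u(t,·)` is in `L²` (with class `f t`), the Bessel potential of order `s`
of `u(t,·)` (a tempered distribution) is an `L²` function `g t`, and `t ↦ g t` is continuous in
`L²`. As usual `‖f t‖_{H^s} = ‖g t‖_{L²}`, up to the equivalence of norms that comes from the `2π`
in the Fourier transform. -/
def ContinuousInSobolev (T s : ℝ) (u : ℝ → ℝ → ℝ) : Prop :=
  ∃ f g : ℝ → Lp ℂ 2 (volume : Measure ℝ),
    (∀ t ∈ Icc 0 T, ∀ᵐ x, f t x = ((u t x : ℝ) : ℂ)) ∧
    (∀ t ∈ Icc 0 T,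
      TemperedDistribution.besselPotential ℝ ℂ s (f t : 𝓢'(ℝ, ℂ)) = (g t : 𝓢'(ℝ, ℂ))) ∧
    ContinuousOn g (Icc 0 T)

/-- `u ∈ C([0,T]; H^s(ℝ))` is a strong solution of the Cauchy problem
`u_t - u_{txx} = ∂_x (2 + ∂_x) [(2 - ∂_x) u]²`, `u(0,·) = u₀`.

For `s > 5/2` every element of `H^s(ℝ)` has exactly one continuous representative, which is then
of class `C²`; `u(t,·)` denotes that representative, so that `deriv (u t)` is the classical
derivative. The equation holds at every time `0 < t < T` in the sense of tempered distributions
in `x`: for every Schwartz function `ψ`,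
`d/dt ⟨u(t), ψ - ψ''⟩ = ⟨(2u - u_x)²(t), ψ'' - 2ψ'⟩`.
For `u ∈ C([0,T]; H^s)` this is the same as `u ∈ C¹([0,T]; H^{s-1})` together with the equation
in `H^{s-3}`. -/
structure IsStrongSolution (T s : ℝ) (u₀ : ℝ → ℝ) (u : ℝ → ℝ → ℝ) : Prop where
  continuous_sobolev : ContinuousInSobolev T s u
  continuous_rep : ∀ t ∈ Icc 0 T, Continuous (u t)
  equation : ∀ t ∈ Ioo 0 T, ∀ ψ : 𝓢(ℝ, ℝ),
    HasDerivAt (fun τ => ∫ x, u τ x * (ψ x - iteratedDeriv 2 ψ x))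
      (∫ x, (2 * u t x - deriv (u t) x) ^ 2 * (iteratedDeriv 2 ψ x - 2 * deriv ψ x)) t
  initial : u 0 = u₀

/-- A sub-multiplicative weight: a non-negative `v` with `v (x + y) ≤ v x * v y`. -/
structure IsSubmultiplicativeWeight (v : ℝ → ℝ) : Prop where
  nonneg : ∀ x, 0 ≤ v x
  submul : ∀ x y, v (x + y) ≤ v x * v y

/-- The positive function `φ` is `v`-moderate with constant `C₀ > 0`. -/
structure IsModerateWith (φ v : ℝ → ℝ) (C₀ : ℝ) : Prop where
  pos : ∀ x, 0 < φ x
  const_pos : 0 < C₀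
  le : ∀ x y, φ (x + y) ≤ C₀ * v x * φ y

/-- `φ` is an admissible weight, with the sub-multiplicative weight `v` and the constants `A`
(in `|φ'| ≤ A |φ|`) and `C₀` (in the moderateness condition) as witnesses. -/
structure IsAdmissibleWeightWith (φ v : ℝ → ℝ) (A C₀ : ℝ) : Prop where
  locally_absolutely_continuous : ∀ a b : ℝ, AbsolutelyContinuousOnInterval φ a b
  submultiplicative : IsSubmultiplicativeWeight v
  moderate : IsModerateWith φ v C₀
  inf_pos : 0 < ⨅ x, v x
  integrable : Integrable (fun x => v x / Real.exp |x|)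
  const_pos : 0 < A
  deriv_le : ∀ᵐ x, |deriv φ x| ≤ A * |φ x|

/-- `‖f φ‖_p + ‖f' φ‖_p + ‖f'' φ‖_p`, as an extended non-negative real. -/
noncomputable def weightedNorm (φ : ℝ → ℝ) (p : ℝ≥0∞) (f : ℝ → ℝ) : ℝ≥0∞ :=
  eLpNorm (fun x => f x * φ x) p volume
    + eLpNorm (fun x => deriv f x * φ x) p volume
    + eLpNorm (fun x => iteratedDeriv 2 f x * φ x) p volume

/-- `M = sup_{t ∈ [0,T]} (‖u(t)‖_∞ + ‖u_x(t)‖_∞ + ‖u_{xx}(t)‖_∞)`, as an extended non-negative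
real. -/
noncomputable def supNorm (T : ℝ) (u : ℝ → ℝ → ℝ) : ℝ≥0∞ :=
  ⨆ t ∈ Icc 0 T, (eLpNorm (u t) ∞ volume + eLpNorm (deriv (u t)) ∞ volume
    + eLpNorm (iteratedDeriv 2 (u t)) ∞ volume)

/-! Put F = (2u - u_x)². Inverting 1 - ∂² turns the equation into u_t = -F + (3r - l)/2, where l and
r are the convolutions of F with the two one-sided exponentials (`leftExp`, `rightExp`). Since l' =
F - l and r' = r - F, the nonlocal part costs no derivative. F is quadratic: one factor is bounded
by a multiple of M, the other is measured in weighted L^p. Convolution with e^{-|x|} is bounded in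
weighted L^p because φ is moderate and v e^{-|x|} is integrable (`eLpNorm_conv_exp_neg_abs_mul_le`).

So u and u_x can be integrated in time at fixed x. For u_xx this would require u_xxx, which need not
exist as a function for s near 5/2. However, u_x solves the transport equation ∂_t u_x = c ∂_x u_x +
g with c = 2(2u - u_x) and a source g free of u_xx. Comparing u_x along two neighbouring
characteristics and dividing by their distance bounds u_xx (`abs_deriv_le_along_characteristic`). As
|c| and |c_x| are at most 6M, over a time δ the characteristics change distances, L^p norms and the
weight only by factors exp(O(Mδ)).

The resulting inequality is closed by Gronwall (`le_exp_mul_of_local_sup_bound`), which needs norms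
known to be finite. Hence φ is first replaced by min(φ, N), which is moderate and of exponential
variation with constants independent of N (`IsAdmissibleWeightWith.isTameWeight_min`). Its norms are
finite because u, u_x, u_xx are bounded in L² ∩ L^∞ uniformly in time and p ≥ 2. Then N → ∞
(`tendsto_eLpNorm_mul_min`).

The regularity comes from Cauchy–Schwarz on the Fourier side
(`ContinuousInSobolev.exists_derivatives`), and testing with (1 - ∂²)⁻¹η makes the weak equation
pointwise (`IsStrongSolution.sub_eq_integral_evolutionRHS`). -/

/-! ### L^p inequalities, Gronwall and elementary facts on weights -/

/-- Minkowski's integral inequality for a finite measure, with a uniform bound of the slices. -/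
theorem eLpNorm_lintegral_le_measure_univ_mul {X Y : Type*} [MeasurableSpace X]
    [MeasurableSpace Y] (μ : Measure X) [SFinite μ] (ν : Measure Y) [IsFiniteMeasure ν]
    {p : ℝ≥0∞} (hp : 1 ≤ p) {f : X → Y → ℝ≥0∞} (hf : Measurable (Function.uncurry f)) {B : ℝ≥0∞}
    (hB : ∀ y, eLpNorm (fun x => f x y) p μ ≤ B) :
    eLpNorm (fun x => ∫⁻ y, f x y ∂ν) p μ ≤ ν univ * B := by
  rcases eq_or_ne p ∞ with rfl | hp_top
  · have h1 : ∀ᵐ x ∂μ, ∀ᵐ y ∂ν, f x y ≤ B := by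
      refine (Measure.ae_ae_comm (p := fun x y => f x y ≤ B)
        (measurableSet_le hf measurable_const)).2 ?_
      refine Filter.Eventually.of_forall fun y => ?_
      have := ae_le_eLpNormEssSup (f := fun x => f x y) (μ := μ)
      filter_upwards [this] with x hx
      exact hx.trans (by simpa using hB y)
    rw [eLpNorm_exponent_top]
    refine essSup_le_of_ae_le _ ?_
    filter_upwards [h1] with x hx
    calc ∫⁻ y, f x y ∂ν ≤ ∫⁻ _, B ∂ν := lintegral_mono_ae hx
      _ = ν univ * B := by simp [mul_comm]
  · have hp0 : p ≠ 0 := (zero_lt_one.trans_le hp).ne'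
    set P := p.toReal with hP
    have hP0 : 0 < P := ENNReal.toReal_pos hp0 hp_top
    have hP1 : 1 ≤ P := by simpa using ENNReal.toReal_mono hp_top hp
    have hslice : ∀ x, Measurable (f x) := fun x => hf.comp measurable_prodMk_left
    -- Because the slices are bounded uniformly in y, the power-mean inequality in y followed by
    -- Tonelli suffices; no duality argument is needed.
    have hJ : ∀ x, (∫⁻ y, f x y ∂ν) ^ P ≤ ν univ ^ (P - 1) * ∫⁻ y, f x y ^ P ∂ν := by
      intro x
      have h := eLpNorm_le_eLpNorm_mul_rpow_measure_univ (μ := ν) hp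
        (hslice x).aestronglyMeasurable
      rw [eLpNorm_one_eq_lintegral_enorm, eLpNorm_eq_lintegral_rpow_enorm_toReal hp0 hp_top] at h
      simp only [enorm_eq_self] at h
      have h2 := ENNReal.rpow_le_rpow h hP0.le
      rw [ENNReal.mul_rpow_of_nonneg _ _ hP0.le, ← ENNReal.rpow_mul, ← ENNReal.rpow_mul] at h2
      have e1 : 1 / p.toReal * P = 1 := by rw [← hP]; field_simp
      have e2 : (1 / (1 : ℝ≥0∞).toReal - 1 / p.toReal) * P = P - 1 := by
        rw [← hP]; simp; field_simp
      rw [e1, e2, ENNReal.rpow_one, mul_comm] at h2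
      exact h2
    have hB' : ∀ y, ∫⁻ x, f x y ^ P ∂μ ≤ B ^ P := by
      intro y
      have h := hB y
      rw [eLpNorm_eq_lintegral_rpow_enorm_toReal hp0 hp_top] at h
      have h2 := ENNReal.rpow_le_rpow h hP0.le
      rw [← ENNReal.rpow_mul] at h2
      have e1 : 1 / p.toReal * P = 1 := by rw [← hP]; field_simp
      rw [e1, ENNReal.rpow_one] at h2
      simpa using h2
    rw [eLpNorm_eq_lintegral_rpow_enorm_toReal hp0 hp_top]
    simp only [enorm_eq_self]
    rw [← hP]
    have key : ∫⁻ x, (∫⁻ y, f x y ∂ν) ^ P ∂μ ≤ (ν univ * B) ^ P := by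
      calc ∫⁻ x, (∫⁻ y, f x y ∂ν) ^ P ∂μ
          ≤ ∫⁻ x, ν univ ^ (P - 1) * ∫⁻ y, f x y ^ P ∂ν ∂μ := lintegral_mono hJ
        _ = ν univ ^ (P - 1) * ∫⁻ x, ∫⁻ y, f x y ^ P ∂ν ∂μ := by
            rw [lintegral_const_mul']
            exact ENNReal.rpow_ne_top_of_nonneg (by linarith) (measure_ne_top _ _)
        _ = ν univ ^ (P - 1) * ∫⁻ y, ∫⁻ x, f x y ^ P ∂μ ∂ν := by
            rw [lintegral_lintegral_swap]
            exact (hf.pow_const P).aemeasurable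
        _ ≤ ν univ ^ (P - 1) * ∫⁻ _, B ^ P ∂ν := by gcongr with y; exact hB' y
        _ = (ν univ * B) ^ P := by
            rw [lintegral_const, ENNReal.mul_rpow_of_nonneg _ _ hP0.le, mul_comm (B ^ P),
              ← mul_assoc]
            congr 1
            rcases eq_or_ne (ν univ) 0 with h0 | h0
            · simp [h0, hP0]
            · nth_rewrite 2 [← ENNReal.rpow_one (ν univ)]
              rw [← ENNReal.rpow_add _ _ h0 (measure_ne_top _ _)]
              congr 1; ring
    calc (∫⁻ x, (∫⁻ y, f x y ∂ν) ^ P ∂μ) ^ (1 / P) ≤ ((ν univ * B) ^ P) ^ (1 / P) := by gcongr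
      _ = ν univ * B := by
        rw [← ENNReal.rpow_mul, mul_one_div_cancel hP0.ne', ENNReal.rpow_one]

/-- Precomposition with an antilipschitz map of the line is bounded on `L^p`. -/
theorem eLpNorm_comp_le_of_antilipschitzWith {q : ℝ → ℝ} {K : NNReal} (hK : 1 ≤ K)
    (hq : AntilipschitzWith K q) (hqc : Continuous q) {p : ℝ≥0∞} (hp : 1 ≤ p) {f : ℝ → ℝ}
    (hf : Continuous f) : eLpNorm (fun x => f (q x)) p volume ≤ K * eLpNorm f p volume := by
  -- Lebesgue measure on the line is one-dimensional Hausdorff measure, for which an antilipschitz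
  -- map controls preimages; q need not be differentiable.
  have hmap : Measure.map q volume ≤ (K : ℝ≥0∞) • (volume : Measure ℝ) := by
    refine Measure.le_iff.2 fun s hs => ?_
    rw [Measure.map_apply hqc.measurable hs]
    have := hq.hausdorffMeasure_preimage_le (d := 1) zero_le_one s
    simpa [hausdorffMeasure_real] using this
  have h1 : eLpNorm (fun x => f (q x)) p volume = eLpNorm f p (Measure.map q volume) := by
    rw [eLpNorm_map_measure hf.aestronglyMeasurable hqc.aemeasurable]; rfl
  rw [h1]
  refine (eLpNorm_mono_measure f hmap).trans ?_
  have hK1 : (1 : ℝ≥0∞) ≤ K := by exact_mod_cast hK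
  rcases eq_or_ne p ∞ with rfl | hp_top
  · rw [eLpNorm_exponent_top]
    exact (eLpNormEssSup_mono_measure f Measure.smul_absolutelyContinuous).trans
      (le_mul_of_one_le_left zero_le hK1)
  · rw [eLpNorm_smul_measure_of_ne_top hp_top, smul_eq_mul]
    gcongr
    have : (1 / p).toReal ≤ 1 := by
      have := ENNReal.toReal_mono ENNReal.one_ne_top (ENNReal.div_le_of_le_mul (by simpa using hp) : 1 / p ≤ 1)
      simpa using this
    calc (K : ℝ≥0∞) ^ (1 / p).toReal ≤ (K : ℝ≥0∞) ^ (1 : ℝ) :=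
          ENNReal.rpow_le_rpow_of_exponent_le hK1 this
      _ = K := ENNReal.rpow_one _

/-- A bounded function with bounded `L²` norm has a bounded `L^p` norm for `2 ≤ p`. -/
theorem exists_eLpNorm_le_of_two_le {p : ℝ≥0∞} (hp : 2 ≤ p) (B : ℝ) {R : ℝ≥0∞} (hR : R ≠ ∞) :
    ∃ R' : ℝ≥0∞, R' ≠ ∞ ∧ ∀ f : ℝ → ℝ, (∀ x, |f x| ≤ B) → eLpNorm f 2 volume ≤ R →
      eLpNorm f p volume ≤ R' := by
  rcases eq_or_ne p ∞ with rfl | hp_top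
  · refine ⟨ENNReal.ofReal B, ENNReal.ofReal_ne_top, fun f hf _ => ?_⟩
    rw [eLpNorm_exponent_top]
    exact eLpNormEssSup_le_of_ae_bound (Filter.Eventually.of_forall hf)
  · have hp0 : p ≠ 0 := (zero_lt_two.trans_le hp).ne'
    set P := p.toReal with hP
    have hP2 : 2 ≤ P := by simpa using ENNReal.toReal_mono hp_top hp
    -- Interpolation: |f|^p ≤ B^{p-2} |f|², integrated. The exponent p - 2 is where 2 ≤ p is needed.
    refine ⟨(ENNReal.ofReal B ^ (P - 2) * R ^ (2 : ℝ)) ^ (1 / P), ?_, fun f hf h2 => ?_⟩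
    · refine ENNReal.rpow_ne_top_of_nonneg (by positivity) (ENNReal.mul_ne_top ?_ ?_)
      · exact ENNReal.rpow_ne_top_of_nonneg (by linarith) ENNReal.ofReal_ne_top
      · exact ENNReal.rpow_ne_top_of_nonneg (by norm_num) hR
    · rw [eLpNorm_eq_lintegral_rpow_enorm_toReal hp0 hp_top, ← hP]
      have h2' := ENNReal.rpow_le_rpow h2 (zero_le_two (α := ℝ))
      rw [eLpNorm_eq_lintegral_rpow_enorm_toReal (by norm_num) (by norm_num),
        ← ENNReal.rpow_mul] at h2'
      simp only [ENNReal.toReal_ofNat, one_div, ne_eq, OfNat.ofNat_ne_zero, not_false_eq_true,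
        inv_mul_cancel₀, ENNReal.rpow_one] at h2'
      gcongr
      calc ∫⁻ x, ‖f x‖ₑ ^ P ≤ ∫⁻ x, ENNReal.ofReal B ^ (P - 2) * ‖f x‖ₑ ^ (2 : ℝ) := by
            refine lintegral_mono fun x => ?_
            have e : P = (P - 2) + 2 := by ring
            nth_rewrite 1 [e]
            rw [ENNReal.rpow_add_of_nonneg _ _ (by linarith) (by norm_num)]
            gcongr
            · rw [← ofReal_norm]
              exact ENNReal.ofReal_le_ofReal (hf x)
        _ = ENNReal.ofReal B ^ (P - 2) * ∫⁻ x, ‖f x‖ₑ ^ (2 : ℝ) := by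
            rw [lintegral_const_mul']
            exact ENNReal.rpow_ne_top_of_nonneg (by linarith) ENNReal.ofReal_ne_top
        _ ≤ _ := by gcongr

/-- A Gronwall inequality in terms of suprema over short intervals. -/
theorem le_exp_mul_of_local_sup_bound {T a b R : ℝ} {n : ℝ → ℝ} (ha : 0 ≤ a) (hb : 0 ≤ b)
    (hn0 : ∀ t ∈ Icc 0 T, 0 ≤ n t) (hnR : ∀ t ∈ Icc 0 T, n t ≤ R)
    (h : ∀ t₁ t₂ S, 0 ≤ t₁ → t₁ ≤ t₂ → t₂ ≤ T → (∀ τ ∈ Icc t₁ t₂, n τ ≤ S) →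
      n t₂ ≤ Real.exp (a * (t₂ - t₁)) * (n t₁ + b * (t₂ - t₁) * S)) :
    ∀ t ∈ Icc 0 T, n t ≤ Real.exp ((a + 4 * b) * t) * n 0 := by
  have step : ∀ s δ, 0 ≤ s → 0 ≤ δ → s + δ ≤ T → Real.exp (a * δ) ≤ 2 → b * δ ≤ 1 / 4 →
      n (s + δ) ≤ Real.exp ((a + 4 * b) * δ) * n s := by
    intro s δ hs hδ hsT h2 h4
    set S := sSup (n '' Icc s (s + δ)) with hS
    have hbdd : BddAbove (n '' Icc s (s + δ)) := by
      refine ⟨R, ?_⟩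
      rintro _ ⟨τ, hτ, rfl⟩
      exact hnR τ ⟨hs.trans hτ.1, hτ.2.trans hsT⟩
    have hle : ∀ τ ∈ Icc s (s + δ), n τ ≤ S := fun τ hτ => le_csSup hbdd ⟨τ, hτ, rfl⟩
    have hns : 0 ≤ n s := hn0 s ⟨hs, by linarith⟩
    have hS0 : 0 ≤ S := hns.trans (hle s ⟨le_rfl, by linarith⟩)
    -- Every τ in the short interval satisfies the hypothesis with the same S, so the supremum
    -- satisfies it too and can be absorbed. The bound R serves only to make S finite; n is not
    -- assumed continuous.
    have hSle : S ≤ Real.exp (a * δ) * (n s + b * δ * S) := by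
      refine csSup_le ⟨n s, s, ⟨le_rfl, by linarith⟩, rfl⟩ ?_
      rintro _ ⟨τ, hτ, rfl⟩
      refine (h s τ S hs hτ.1 (hτ.2.trans hsT)
        fun σ hσ => hle σ ⟨hσ.1, hσ.2.trans hτ.2⟩).trans ?_
      have : τ - s ≤ δ := by linarith [hτ.2]
      have : 0 ≤ τ - s := by linarith [hτ.1]
      gcongr
    set z := Real.exp (a * δ) * (b * δ) with hz
    have hz0 : 0 ≤ z := by positivity
    have hz1 : z ≤ 2 * (b * δ) := by rw [hz]; gcongr
    have h1 : S * (1 - z) ≤ Real.exp (a * δ) * n s := by rw [hz]; nlinarith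
    -- As z ≤ 2bδ ≤ 1/2, one has 1/(1 - z) ≤ 1 + 2z ≤ 1 + 4bδ ≤ e^{4bδ}; this is the origin of the 4
    -- in the rate.
    have h3 : 1 ≤ (1 - z) * Real.exp (4 * b * δ) := by
      have e1 : 1 + 2 * z ≤ Real.exp (4 * b * δ) := by
        have := Real.add_one_le_exp (4 * b * δ)
        linarith
      calc (1 : ℝ) ≤ (1 - z) * (1 + 2 * z) := by nlinarith
        _ ≤ _ := by gcongr; linarith
    calc n (s + δ) ≤ S := hle _ ⟨by linarith, le_rfl⟩
      _ = S * 1 := by ring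
      _ ≤ S * ((1 - z) * Real.exp (4 * b * δ)) := by gcongr
      _ = S * (1 - z) * Real.exp (4 * b * δ) := by ring
      _ ≤ Real.exp (a * δ) * n s * Real.exp (4 * b * δ) := by gcongr
      _ = Real.exp (a * δ + 4 * b * δ) * n s := by rw [Real.exp_add]; ring
      _ = _ := by congr 2; ring
  intro t ht
  -- With δ = t/K this gives aδ ≤ 1/2, hence e^{aδ} ≤ 2, and bδ ≤ 1/4, as the one-step estimate
  -- requires.
  obtain ⟨K, hK⟩ := exists_nat_gt (2 * (a * t) + 4 * (b * t))
  have hat : 0 ≤ a * t := mul_nonneg ha ht.1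
  have hbt : 0 ≤ b * t := mul_nonneg hb ht.1
  have hK0 : (0 : ℝ) < K := by linarith
  set δ := t / K with hδ
  have hδ0 : 0 ≤ δ := div_nonneg ht.1 hK0.le
  have hKδ : K * δ = t := by rw [hδ]; field_simp
  have h4 : b * δ ≤ 1 / 4 := by
    rw [hδ, ← mul_div_assoc, div_le_iff₀ hK0]; linarith
  have h2 : Real.exp (a * δ) ≤ 2 := by
    have : a * δ ≤ 1 / 2 := by
      rw [hδ, ← mul_div_assoc, div_le_iff₀ hK0]; linarith
    have h5 := Real.add_one_le_exp (-(a * δ))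
    rw [Real.exp_neg] at h5
    have h6 : 0 < Real.exp (a * δ) := Real.exp_pos _
    have h7 : (1 / 2 : ℝ) ≤ (Real.exp (a * δ))⁻¹ := by linarith
    rw [le_inv_comm₀ (by norm_num) h6] at h7
    linarith
  have ind : ∀ k : ℕ, k ≤ K → n (k * δ) ≤ Real.exp ((a + 4 * b) * (k * δ)) * n 0 := by
    intro k
    induction k with
    | zero => intro _; simp
    | succ k ih =>
      intro hk
      have hk' : (k : ℝ) * δ + δ ≤ t := by
        have : ((k + 1 : ℕ) : ℝ) ≤ K := by exact_mod_cast hk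
        push_cast at this
        nlinarith
      have := step (k * δ) δ (by positivity) hδ0 (hk'.trans ht.2) h2 h4
      have e : ((k + 1 : ℕ) : ℝ) * δ = k * δ + δ := by push_cast; ring
      rw [e]
      refine this.trans ?_
      calc Real.exp ((a + 4 * b) * δ) * n (k * δ)
          ≤ Real.exp ((a + 4 * b) * δ) * (Real.exp ((a + 4 * b) * (k * δ)) * n 0) := by
            gcongr; exact ih (by omega)
        _ = Real.exp ((a + 4 * b) * δ + (a + 4 * b) * (k * δ)) * n 0 := by
            rw [Real.exp_add]; ring
        _ = _ := by congr 2; ring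
  simpa [hKδ] using ind K le_rfl

/-- An absolutely continuous positive function with `|φ'| ≤ A φ` changes at most exponentially. -/
theorem le_exp_mul_of_abs_deriv_le {φ : ℝ → ℝ} {A : ℝ} (hA : 0 < A)
    (hac : ∀ a b : ℝ, AbsolutelyContinuousOnInterval φ a b) (hpos : ∀ x, 0 < φ x)
    (hd : ∀ᵐ x, |deriv φ x| ≤ A * |φ x|) (hφ : Continuous φ) (x y : ℝ) :
    φ x ≤ Real.exp (A * |x - y|) * φ y := by
  -- Integral form of Gronwall: for the right-hand side G, the function e^{-Ax} G(x) is
  -- nonincreasing.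
  have inc : ∀ ψ : ℝ → ℝ, Continuous ψ → (∀ x, 0 < ψ x) → ∀ y,
      (∀ x, y ≤ x → ψ x ≤ ψ y + ∫ z in y..x, A * ψ z) → ∀ x, y ≤ x →
      ψ x ≤ Real.exp (A * (x - y)) * ψ y := by
    intro ψ hψ hψ0 y h x hyx
    set G : ℝ → ℝ := fun x => ψ y + ∫ z in y..x, A * ψ z with hG
    have hGd : ∀ x, HasDerivAt G (A * ψ x) x := by
      intro x
      have := intervalIntegral.integral_hasDerivAt_right
        ((hψ.const_mul A).intervalIntegrable y x)
        ((hψ.const_mul A).stronglyMeasurableAtFilter _ _) (hψ.const_mul A).continuousAt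
      exact this.const_add (ψ y)
    have hH : ∀ x, HasDerivAt (fun x => Real.exp (-(A * x)) * G x)
        (Real.exp (-(A * x)) * (A * ψ x - A * G x)) x := by
      intro x
      have h1 : HasDerivAt (fun x => Real.exp (-(A * x))) (Real.exp (-(A * x)) * (-(A * 1))) x :=
        (((hasDerivAt_id x).const_mul A).neg).exp
      exact (h1.mul (hGd x)).congr_deriv (by ring)
    have hanti : AntitoneOn (fun x => Real.exp (-(A * x)) * G x) (Ici y) := by
      refine antitoneOn_of_deriv_nonpos (convex_Ici y)
        (fun x _ => (hH x).continuousAt.continuousWithinAt)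
        (fun x _ => (hH x).differentiableAt.differentiableWithinAt) fun x hx => ?_
      rw [(hH x).deriv]
      rw [interior_Ici] at hx
      have := h x (le_of_lt hx)
      have h2 : A * ψ x ≤ A * G x := by gcongr
      exact mul_nonpos_of_nonneg_of_nonpos (Real.exp_pos _).le (by linarith)
    have h3 := hanti (mem_Ici.2 le_rfl) (mem_Ici.2 hyx) hyx
    simp only [hG, intervalIntegral.integral_same, add_zero] at h3
    have h4 : Real.exp (-(A * x)) * ψ x ≤ Real.exp (-(A * y)) * ψ y :=
      le_trans (by gcongr; exact h x hyx) h3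
    calc ψ x = Real.exp (A * x) * (Real.exp (-(A * x)) * ψ x) := by
          rw [← mul_assoc, ← Real.exp_add]; simp
      _ ≤ Real.exp (A * x) * (Real.exp (-(A * y)) * ψ y) := by gcongr
      _ = Real.exp (A * (x - y)) * ψ y := by
          rw [← mul_assoc, ← Real.exp_add]; congr 2; ring
  have hbound : ∀ a b : ℝ, a ≤ b → |φ b - φ a| ≤ ∫ z in a..b, A * φ z := by
    intro a b hab
    rw [← (hac a b).integral_deriv_eq_sub]
    refine (intervalIntegral.abs_integral_le_integral_abs hab).trans ?_
    refine intervalIntegral.integral_mono_ae hab (hac a b).intervalIntegrable_deriv.abs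
      ((hφ.const_mul A).intervalIntegrable _ _) ?_
    filter_upwards [hd] with z hz
    rwa [abs_of_pos (hpos z)] at hz
  rcases le_total y x with hyx | hxy
  · rw [abs_of_nonneg (sub_nonneg.2 hyx)]
    refine inc φ hφ hpos y (fun x hx => ?_) x hyx
    have := (abs_le.1 (hbound y x hx)).2
    linarith
  · rw [abs_of_nonpos (sub_nonpos.2 hxy)]
    -- The case x ≤ y follows by reflecting the line.
    have := inc (fun z => φ (-z)) (hφ.comp continuous_neg) (fun z => hpos _) (-y)
      (fun z hz => ?_) (-x) (by linarith)
    · simp only [neg_neg] at this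
      convert this using 3
      ring
    · have h1 := (abs_le.1 (hbound (-z) y (by linarith))).1
      simp only [neg_neg]
      have h2 : (∫ w in -y..z, A * φ (-w)) = ∫ w in -z..y, A * φ w := by
        rw [intervalIntegral.integral_comp_neg (fun w => A * φ w)]; simp
      rw [h2]
      linarith

/-- `L^p` norms with the truncated weights `min φ N` converge to the one with weight `φ`. -/
theorem tendsto_eLpNorm_mul_min (p : ℝ≥0∞) {f φ : ℝ → ℝ} (hf : Continuous f) (hφ : Continuous φ)
    (hpos : ∀ x, 0 < φ x) :
    Filter.Tendsto (fun N : ℕ => eLpNorm (fun x => f x * min (φ x) N) p volume) Filter.atTop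
      (nhds (eLpNorm (fun x => f x * φ x) p volume)) := by
  refine tendsto_of_le_liminf_of_limsup_le ?_ ?_
  -- Fatou bounds the limit norm by the lower limit: at each x the truncation is inactive for large
  -- N. The upper limit follows from min(φ, N) ≤ φ.
  · refine Lp.eLpNorm_lim_le_liminf_eLpNorm (fun N => ?_) _ ?_
    · exact (hf.mul (hφ.min continuous_const)).aestronglyMeasurable
    · refine Filter.Eventually.of_forall fun x => ?_
      obtain ⟨K, hK⟩ := exists_nat_ge (φ x)
      refine tendsto_const_nhds.congr' ?_
      filter_upwards [Filter.eventually_ge_atTop K] with N hN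
      have : (K : ℝ) ≤ N := by exact_mod_cast hN
      rw [min_eq_left (hK.trans this)]
  · refine Filter.limsup_le_of_le (by isBoundedDefault) (Filter.Eventually.of_forall fun N => ?_)
    refine eLpNorm_mono fun x => ?_
    rw [norm_mul, norm_mul]
    gcongr
    rw [Real.norm_eq_abs, Real.norm_eq_abs, abs_of_pos (hpos x),
      abs_of_nonneg (le_min (hpos x).le (Nat.cast_nonneg _))]
    exact min_le_left _ _

/-! ### Convolution with one-sided exponentials -/

/-- Convolution with `e^{-y} 1_{y ≥ 0}`. -/
noncomputable def leftExp (F : ℝ → ℝ) (x : ℝ) : ℝ := ∫ y in Ici 0, Real.exp (-y) * F (x - y)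

/-- Convolution with `e^{y} 1_{y ≤ 0}`. -/
noncomputable def rightExp (F : ℝ → ℝ) (x : ℝ) : ℝ := ∫ y in Ici 0, Real.exp (-y) * F (x + y)

/-- Reflection transfers facts about `leftExp` to `rightExp`. -/
theorem rightExp_eq_leftExp_neg (F : ℝ → ℝ) (x : ℝ) :
    rightExp F x = leftExp (fun z => F (-z)) (-x) := by
  simp only [rightExp, leftExp]
  congr 1 with y
  congr 2
  ring

theorem integrableOn_exp_neg_Ici : IntegrableOn (fun y : ℝ => Real.exp (-y)) (Ici 0) :=
  (integrableOn_Ici_iff_integrableOn_Ioi).2 (integrableOn_exp_neg_Ioi 0)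

theorem integrable_exp_neg_abs : Integrable (fun y : ℝ => Real.exp (-|y|)) := by
  rw [← integrableOn_univ, ← Iio_union_Ici (a := (0 : ℝ)), integrableOn_union]
  constructor
  · refine (integrableOn_exp_Iic 0).mono_set Iio_subset_Iic_self |>.congr_fun (fun y hy => ?_)
      measurableSet_Iio
    simp only [abs_of_neg (mem_Iio.1 hy), neg_neg]
  · refine integrableOn_exp_neg_Ici.congr_fun (fun y hy => ?_) measurableSet_Ici
    simp only [abs_of_nonneg (mem_Ici.1 hy)]

/-- The substitution z = x - y moves x out of F, so that differentiation needs only continuity of F.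
-/
theorem leftExp_eq_exp_mul (F : ℝ → ℝ) (x : ℝ) :
    leftExp F x = Real.exp (-x) * ∫ z in Iic x, Real.exp z * F z := by
  rw [leftExp, ← integral_const_mul, ← integral_indicator measurableSet_Ici,
    ← integral_indicator measurableSet_Iic, ← integral_sub_left_eq_self _ _ x]
  congr 1 with z
  simp only [indicator, mem_Ici, mem_Iic, sub_nonneg]
  split_ifs with h
  · rw [← mul_assoc, ← Real.exp_add]
    congr 2 <;> ring
  · rfl

section bounded

variable {F : ℝ → ℝ} {B : ℝ}

/-- The kernel e^{-y} 1_{y ≥ 0} is a fundamental solution of 1 + ∂, and its reflection one of 1 - ∂.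
Together they factor the inverse of 1 - ∂², and every derivative of the nonlocal term reduces to F
and the two convolutions. -/
theorem hasDerivAt_leftExp (hF : Continuous F) (hB : ∀ x, |F x| ≤ B) (x : ℝ) :
    HasDerivAt (leftExp F) (F x - leftExp F x) x := by
  have hc : Continuous fun z => Real.exp z * F z := Real.continuous_exp.mul hF
  have hint : ∀ x, IntegrableOn (fun z => Real.exp z * F z) (Iic x) := by
    intro x
    refine Integrable.mono' ((integrableOn_exp_Iic x).mul_const B) hc.aestronglyMeasurable ?_
    refine Filter.Eventually.of_forall fun z => ?_
    rw [norm_mul, Real.norm_eq_abs, Real.norm_eq_abs, abs_of_pos (Real.exp_pos z)]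
    gcongr
    exact hB z
  have hJ : HasDerivAt (fun x => ∫ z in Iic x, Real.exp z * F z) (Real.exp x * F x) x := by
    have h1 : (fun x => ∫ z in Iic x, Real.exp z * F z) =
        fun x => (∫ z in Iic 0, Real.exp z * F z) + ∫ z in (0 : ℝ)..x, Real.exp z * F z := by
      ext w
      rw [← intervalIntegral.integral_Iic_sub_Iic (hint 0) (hint w)]
      ring
    rw [h1]
    exact (intervalIntegral.integral_hasDerivAt_right (hc.intervalIntegrable 0 x)
      (hc.stronglyMeasurableAtFilter _ _) hc.continuousAt).const_add _
  have h2 : leftExp F = fun x => Real.exp (-x) * ∫ z in Iic x, Real.exp z * F z :=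
    funext (leftExp_eq_exp_mul F)
  have h3 : HasDerivAt (fun x => Real.exp (-x)) (Real.exp (-x) * (-1)) x :=
    (hasDerivAt_neg x).exp
  rw [leftExp_eq_exp_mul, h2]
  refine (h3.mul hJ).congr_deriv ?_
  rw [← mul_assoc, ← Real.exp_add]
  simp
  ring

theorem hasDerivAt_rightExp (hF : Continuous F) (hB : ∀ x, |F x| ≤ B) (x : ℝ) :
    HasDerivAt (rightExp F) (rightExp F x - F x) x := by
  have h := (hasDerivAt_leftExp (F := fun z => F (-z)) (hF.comp continuous_neg)
    (fun x => hB (-x)) (-x)).comp x (hasDerivAt_neg x)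
  have e : rightExp F = leftExp (fun z => F (-z)) ∘ fun x => -x :=
    funext (rightExp_eq_leftExp_neg F)
  rw [e]
  refine h.congr_deriv ?_
  simp

theorem abs_leftExp_le (hB : ∀ x, |F x| ≤ B) (x : ℝ) : |leftExp F x| ≤ B := by
  have h : ∫ y in Ici (0 : ℝ), Real.exp (-y) * B = B := by
    rw [integral_mul_const, integral_Ici_eq_integral_Ioi, integral_exp_neg_Ioi_zero, one_mul]
  rw [← h, leftExp]
  rw [← Real.norm_eq_abs]
  refine norm_integral_le_of_norm_le (integrableOn_exp_neg_Ici.mul_const B)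
    (Filter.Eventually.of_forall fun y => ?_)
  rw [norm_mul, Real.norm_eq_abs, Real.norm_eq_abs, abs_of_pos (Real.exp_pos _)]
  gcongr
  exact hB _

theorem abs_rightExp_le (hB : ∀ x, |F x| ≤ B) (x : ℝ) : |rightExp F x| ≤ B := by
  rw [rightExp_eq_leftExp_neg]
  exact abs_leftExp_le (fun z => hB (-z)) _

theorem integrable_exp_neg_abs_mul {G : ℝ → ℝ} (hG : Continuous G) (hB : ∀ x, |G x| ≤ B) :
    Integrable (fun y => Real.exp (-|y|) * G y) := by
  refine Integrable.mono' (integrable_exp_neg_abs.mul_const B)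
    (by fun_prop) (Filter.Eventually.of_forall fun y => ?_)
  rw [norm_mul, Real.norm_eq_abs, Real.norm_eq_abs, abs_of_pos (Real.exp_pos _)]
  gcongr
  exact hB _

/-- Both one-sided kernels lie below e^{-|y|}, the kernel against which v is assumed integrable. -/
theorem abs_leftExp_le_integral {m : ℝ → ℝ} (hm : Continuous m) (hmB : ∀ x, |m x| ≤ B)
    (hFm : ∀ x, |F x| ≤ m x) (x : ℝ) :
    |leftExp F x| ≤ ∫ y, Real.exp (-|y|) * m (x - y) := by
  have hi := integrable_exp_neg_abs_mul (G := fun y => m (x - y)) (by fun_prop)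
    (fun y => hmB (x - y))
  have h0 : ∀ y, 0 ≤ m y := fun y => (abs_nonneg _).trans (hFm y)
  refine le_trans ?_ (setIntegral_le_integral (s := Ici 0) hi
    (Filter.Eventually.of_forall fun y => mul_nonneg (Real.exp_pos _).le (h0 _)))
  rw [leftExp, ← Real.norm_eq_abs]
  refine norm_integral_le_of_norm_le hi.integrableOn ?_
  filter_upwards [ae_restrict_mem measurableSet_Ici] with y hy
  rw [norm_mul, Real.norm_eq_abs, Real.norm_eq_abs, abs_of_pos (Real.exp_pos _),
    abs_of_nonneg (mem_Ici.1 hy)]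
  gcongr
  exact hFm _

theorem abs_rightExp_le_integral {m : ℝ → ℝ} (hm : Continuous m) (hmB : ∀ x, |m x| ≤ B)
    (hFm : ∀ x, |F x| ≤ m x) (x : ℝ) :
    |rightExp F x| ≤ ∫ y, Real.exp (-|y|) * m (x - y) := by
  rw [rightExp_eq_leftExp_neg]
  refine (abs_leftExp_le_integral (m := fun z => m (-z)) (hm.comp continuous_neg)
    (fun x => hmB (-x)) (fun x => hFm (-x)) (-x)).trans (le_of_eq ?_)
  rw [← integral_neg_eq_self]
  congr 1 with y
  simp only [abs_neg]
  congr 2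
  ring

end bounded

theorem continuous_uncurry_leftExp {F : ℝ → ℝ → ℝ} {B : ℝ}
    (hF : Continuous (Function.uncurry F)) (hB : ∀ t x, |F t x| ≤ B) :
    Continuous (Function.uncurry fun t x => leftExp (F t) x) := by
  refine continuous_of_dominated (F := fun (q : ℝ × ℝ) y => Real.exp (-y) * F q.1 (q.2 - y))
    (bound := fun y => Real.exp (-y) * B) (fun q => ?_) (fun q => ?_)
    (integrableOn_exp_neg_Ici.mul_const B) ?_
  · have : Continuous fun y => F q.1 (q.2 - y) :=
      hF.comp (continuous_const.prodMk (continuous_const.sub continuous_id))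
    exact ((Real.continuous_exp.comp continuous_neg).mul this).aestronglyMeasurable
  · refine Filter.Eventually.of_forall fun y => ?_
    rw [norm_mul, Real.norm_eq_abs, Real.norm_eq_abs, abs_of_pos (Real.exp_pos _)]
    gcongr
    exact hB _ _
  · refine Filter.Eventually.of_forall fun y => ?_
    exact continuous_const.mul
      (hF.comp (continuous_fst.prodMk (continuous_snd.sub continuous_const)))

theorem continuous_uncurry_rightExp {F : ℝ → ℝ → ℝ} {B : ℝ}
    (hF : Continuous (Function.uncurry F)) (hB : ∀ t x, |F t x| ≤ B) :
    Continuous (Function.uncurry fun t x => rightExp (F t) x) := by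
  have h := continuous_uncurry_leftExp (F := fun t z => F t (-z)) (B := B)
    (hF.comp (continuous_fst.prodMk continuous_snd.neg)) (fun t x => hB t (-x))
  have := h.comp (continuous_fst.prodMk continuous_snd.neg : Continuous fun q : ℝ × ℝ => (q.1, -q.2))
  refine this.congr fun q => ?_
  simp [Function.uncurry, rightExp_eq_leftExp_neg]

/-! ### Testing against Schwartz functions -/

theorem SchwartzMap.integrable_bounded_mul (ψ : 𝓢(ℝ, ℝ)) {f : ℝ → ℝ} {B : ℝ} (hf : Continuous f)
    (hB : ∀ x, |f x| ≤ B) : Integrable fun x => f x * ψ x := by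
  refine (ψ.integrable (μ := volume)).bdd_mul hf.aestronglyMeasurable (c := B) ?_
  exact Filter.Eventually.of_forall hB

theorem SchwartzMap.integral_bounded_mul_deriv (ψ : 𝓢(ℝ, ℝ)) {f f' : ℝ → ℝ} {B B' : ℝ}
    (hf : ∀ x, HasDerivAt f (f' x) x) (hf' : Continuous f') (hB : ∀ x, |f x| ≤ B)
    (hB' : ∀ x, |f' x| ≤ B') : ∫ x, f x * deriv ψ x = -∫ x, f' x * ψ x := by
  have hfc : Continuous f := continuous_iff_continuousAt.2 fun x => (hf x).continuousAt
  refine integral_mul_deriv_eq_deriv_mul_of_integrable (fun x _ => hf x)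
    (fun x _ => ψ.differentiableAt.hasDerivAt) ?_ ?_ ?_
  · exact (SchwartzMap.derivCLM ℝ ℝ ψ).integrable_bounded_mul hfc hB
  · exact ψ.integrable_bounded_mul hf' hB'
  · exact ψ.integrable_bounded_mul hfc hB

theorem SchwartzMap.iteratedDeriv_two_eq (ψ : 𝓢(ℝ, ℝ)) :
    iteratedDeriv 2 ψ = SchwartzMap.derivCLM ℝ ℝ (SchwartzMap.derivCLM ℝ ℝ ψ) := by
  rw [iteratedDeriv_succ, iteratedDeriv_one]
  ext x
  rw [SchwartzMap.derivCLM_apply]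
  congr 1

/-- The weak form of `S - S'' = F + 2 F'` for the nonlocal part `S` of the equation. -/
theorem integral_nonlocal_mul_sub_deriv_two {F F' : ℝ → ℝ} {B B' : ℝ}
    (hF : ∀ x, HasDerivAt F (F' x) x) (hF' : Continuous F') (hB : ∀ x, |F x| ≤ B)
    (hB' : ∀ x, |F' x| ≤ B') (ψ : 𝓢(ℝ, ℝ)) :
    ∫ x, (-F x + (3 * rightExp F x - leftExp F x) / 2) * (ψ x - iteratedDeriv 2 ψ x) =
      ∫ x, F x * (iteratedDeriv 2 ψ x - 2 * deriv ψ x) := by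
  have hFc : Continuous F := continuous_iff_continuousAt.2 fun x => (hF x).continuousAt
  set a := leftExp F with ha
  set b := rightExp F with hb
  have had := hasDerivAt_leftExp hFc hB
  have hbd := hasDerivAt_rightExp hFc hB
  have hac : Continuous a := continuous_iff_continuousAt.2 fun x => (had x).continuousAt
  have hbc : Continuous b := continuous_iff_continuousAt.2 fun x => (hbd x).continuousAt
  have haB := abs_leftExp_le hB
  have hbB := abs_rightExp_le hB
  -- From a' = F - a and b' = b - F: S' = S₁ and S'' = S₂ = S - F - 2F'. Two integrations by parts
  -- move 1 - ∂² onto S, producing F + 2F'; the term F cancels against the local part -F.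
  set S : ℝ → ℝ := fun x => (3 * b x - a x) / 2 with hS
  set S₁ : ℝ → ℝ := fun x => (3 * b x + a x) / 2 - 2 * F x with hS₁
  set S₂ : ℝ → ℝ := fun x => S x - F x - 2 * F' x with hS₂
  have hSd : ∀ x, HasDerivAt S (S₁ x) x := fun x =>
    ((((hbd x).const_mul 3).sub (had x)).div_const 2).congr_deriv (by simp only [hS₁]; ring)
  have hS₁d : ∀ x, HasDerivAt S₁ (S₂ x) x := fun x =>
    (((((hbd x).const_mul 3).add (had x)).div_const 2).sub ((hF x).const_mul 2)).congr_deriv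
      (by simp only [hS₂, hS]; ring)
  have hSB : ∀ x, |S x| ≤ 2 * B := fun x => by
    have := abs_le.1 (haB x); have := abs_le.1 (hbB x)
    rw [abs_le]; constructor <;> simp only [hS] <;> linarith
  have hS₁B : ∀ x, |S₁ x| ≤ 4 * B := fun x => by
    have := abs_le.1 (haB x); have := abs_le.1 (hbB x); have := abs_le.1 (hB x)
    rw [abs_le]; constructor <;> simp only [hS₁] <;> linarith
  have hS₂B : ∀ x, |S₂ x| ≤ 3 * B + 2 * B' := fun x => by
    have := abs_le.1 (hSB x); have := abs_le.1 (hB x); have := abs_le.1 (hB' x)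
    rw [abs_le]; constructor <;> simp only [hS₂] <;> linarith
  have hSc : Continuous S := by fun_prop
  have hS₁c : Continuous S₁ := by fun_prop
  have hS₂c : Continuous S₂ := by fun_prop
  set ψ₁ := SchwartzMap.derivCLM ℝ ℝ ψ with hψ₁
  set ψ₂ := SchwartzMap.derivCLM ℝ ℝ ψ₁ with hψ₂
  have e2 : iteratedDeriv 2 ψ = ψ₂ := ψ.iteratedDeriv_two_eq
  have e1 : deriv ψ = ψ₁ := rfl
  have e1' : deriv ψ₁ = ψ₂ := rfl
  rw [e2, e1]
  have i1 : ∫ x, S x * ψ₂ x = ∫ x, S₂ x * ψ x := by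
    have h1 := ψ₁.integral_bounded_mul_deriv hSd hS₁c hSB hS₁B
    have h2 := ψ.integral_bounded_mul_deriv hS₁d hS₂c hS₁B hS₂B
    rw [e1'] at h1
    rw [e1] at h2
    rw [h1, h2, neg_neg]
  have i2 : ∫ x, F x * ψ₁ x = -∫ x, F' x * ψ x :=
    ψ.integral_bounded_mul_deriv hF hF' hB hB'
  have j1 := ψ.integrable_bounded_mul hFc hB
  have j2 := ψ.integrable_bounded_mul hF' hB'
  have j3 := ψ.integrable_bounded_mul hSc hSB
  have j4 := ψ₂.integrable_bounded_mul hSc hSB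
  have j5 := ψ₂.integrable_bounded_mul hFc hB
  have j6 := ψ₁.integrable_bounded_mul hFc hB
  have i3 : ∫ x, S₂ x * ψ x = (∫ x, S x * ψ x) - (∫ x, F x * ψ x) - 2 * ∫ x, F' x * ψ x := by
    calc ∫ x, S₂ x * ψ x = ∫ x, (S x * ψ x - F x * ψ x) - 2 * (F' x * ψ x) := by
          congr 1 with x
          simp only [hS₂]
          ring
      _ = _ := by
        rw [integral_sub (by exact j3.sub j1) (j2.const_mul 2), integral_sub j3 j1,
          integral_const_mul]
  have l : ∫ x, (-F x + S x) * (ψ x - ψ₂ x) =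
      (∫ x, F x * ψ₂ x) - (∫ x, F x * ψ x) + (∫ x, S x * ψ x) - ∫ x, S x * ψ₂ x := by
    calc ∫ x, (-F x + S x) * (ψ x - ψ₂ x)
        = ∫ x, (F x * ψ₂ x - F x * ψ x) + (S x * ψ x - S x * ψ₂ x) := by
          congr 1 with x
          ring
      _ = _ := by
        rw [integral_add (by exact j5.sub j1) (by exact j3.sub j4), integral_sub j5 j1,
          integral_sub j3 j4]
        ring
  have r : ∫ x, F x * (ψ₂ x - 2 * ψ₁ x) = (∫ x, F x * ψ₂ x) - 2 * ∫ x, F x * ψ₁ x := by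
    rw [← integral_const_mul, ← integral_sub j5 (j6.const_mul 2)]
    congr 1 with x
    ring
  rw [r, i2]
  refine l.trans ?_
  rw [i1, i3]
  ring

/-- `1 - ∂²` is onto on Schwartz functions. -/
theorem SchwartzMap.exists_sub_iteratedDeriv_two_eq (η : 𝓢(ℝ, ℝ)) :
    ∃ ψ : 𝓢(ℝ, ℝ), ∀ x, ψ x - iteratedDeriv 2 ψ x = η x := by
  -- With the 2π in the exponent of the Fourier transform, 1 - ∂² has symbol 1 + (2π|ξ|)², and g is
  -- its reciprocal.
  set g : ℝ → ℝ := fun x => (1 + ‖(2 * Real.pi) • x‖ ^ 2) ^ (-1 : ℝ) with hg_def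
  have hg : g.HasTemperateGrowth :=
    (Function.hasTemperateGrowth_one_add_norm_sq_rpow ℝ (-1)).comp
      ((2 * Real.pi) • ContinuousLinearMap.id ℝ ℝ).hasTemperateGrowth
  have hn := Function.hasTemperateGrowth_norm_sq ℝ
  set ηc : 𝓢(ℝ, ℂ) := SchwartzMap.postcompCLM (𝕜 := ℝ) Complex.ofRealCLM η with hηc
  set ψc : 𝓢(ℝ, ℂ) := SchwartzMap.fourierMultiplierCLM ℂ g ηc with hψc
  have h1 : Laplacian.laplacian ψc = ψc - ηc := by
    rw [SchwartzMap.laplacian_eq_fourierMultiplierCLM, hψc,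
      SchwartzMap.fourierMultiplierCLM_fourierMultiplierCLM_apply hn hg]
    have e : (1 : ℝ → ℝ) = g + ((2 * Real.pi) ^ 2) • ((fun x : ℝ => ‖x‖ ^ 2) * g) := by
      ext x
      have h0 : (0 : ℝ) < 1 + ‖(2 * Real.pi) • x‖ ^ 2 := by positivity
      simp only [hg_def, Pi.one_apply, Pi.add_apply, Pi.smul_apply, Pi.mul_apply, smul_eq_mul,
        Real.rpow_neg_one]
      rw [smul_eq_mul] at h0
      rw [norm_mul, mul_pow, Real.norm_eq_abs (2 * Real.pi), sq_abs] at h0 ⊢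
      field_simp
    have hng : ((fun x : ℝ => ‖x‖ ^ 2) * g).HasTemperateGrowth := hn.mul hg
    have e2 : SchwartzMap.fourierMultiplierCLM ℂ (1 : ℝ → ℝ) ηc = ηc := by
      have : (1 : ℝ → ℝ) = fun _ => 1 := rfl
      rw [this, SchwartzMap.fourierMultiplierCLM_const]
      simp
    have e3 : SchwartzMap.fourierMultiplierCLM ℂ (1 : ℝ → ℝ) ηc =
        SchwartzMap.fourierMultiplierCLM ℂ g ηc +
          ((2 * Real.pi) ^ 2) • SchwartzMap.fourierMultiplierCLM ℂ ((fun x : ℝ => ‖x‖ ^ 2) * g) ηc := by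
      have hs : (((2 * Real.pi) ^ 2) • ((fun x : ℝ => ‖x‖ ^ 2) * g)).HasTemperateGrowth :=
        (Function.HasTemperateGrowth.const _).mul hng
      rw [e, SchwartzMap.fourierMultiplierCLM_apply, SchwartzMap.smulLeftCLM_add hg hs,
        SchwartzMap.smulLeftCLM_smul hng, SchwartzMap.fourierMultiplierCLM_apply,
        SchwartzMap.fourierMultiplierCLM_apply]
      simp [FourierTransform.fourierInv_add, FourierTransform.fourierInv_smul]
    rw [e2] at e3
    nth_rewrite 3 [e3]
    rw [neg_smul]
    abel
  -- The multiplier acts on complex functions; since η is real and 1 - ∂² has real coefficients, the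
  -- real part of the solution is again a solution.
  refine ⟨SchwartzMap.postcompCLM (𝕜 := ℝ) Complex.reCLM ψc, fun x => ?_⟩
  have h2 : iteratedDeriv 2 (fun x => (ψc x).re) x = (iteratedDeriv 2 ψc x).re := by
    have hre : ∀ f : 𝓢(ℝ, ℂ), deriv (fun x => (f x).re) = fun x => (deriv f x).re := fun f =>
      funext fun x => (Complex.reCLM.hasFDerivAt.comp_hasDerivAt x (f.hasDerivAt x)).deriv
    rw [iteratedDeriv_succ, iteratedDeriv_one, iteratedDeriv_succ, iteratedDeriv_one, hre]
    exact congrFun (hre (SchwartzMap.derivCLM ℝ ℂ ψc)) x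
  have h3 : iteratedDeriv 2 ψc x = ψc x - ηc x := by
    have := congrArg (fun f : 𝓢(ℝ, ℂ) => f x) h1
    simp only [SchwartzMap.laplacian_apply] at this
    rw [InnerProductSpace.laplacian_eq_iteratedDeriv_real] at this
    simpa using this
  have h4 : iteratedDeriv 2 (SchwartzMap.postcompCLM (𝕜 := ℝ) Complex.reCLM ψc) x =
      iteratedDeriv 2 (fun x => (ψc x).re) x := rfl
  rw [h4, h2, h3]
  simp [hηc, SchwartzMap.postcompCLM_apply]

/-! ### Sobolev embedding through Fourier multipliers -/

section sobolev

open scoped FourierTransform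

/-- The inverse Fourier transforms on `L²` and on `L¹` agree on `L¹ ∩ L²`. -/
theorem fourierInv_coeFn_ae_eq (h : Lp ℂ 2 (volume : Measure ℝ)) (hh : Integrable (h : ℝ → ℂ)) :
    ((𝓕⁻ h : Lp ℂ 2 (volume : Measure ℝ)) : ℝ → ℂ) =ᵐ[volume] 𝓕⁻ (h : ℝ → ℂ) := by
  have hcont : Continuous (𝓕⁻ (h : ℝ → ℂ)) := by
    rw [Real.fourierInv_eq_fourier_comp_neg]
    exact VectorFourier.fourierIntegral_continuous Real.continuous_fourierChar
      continuous_inner hh.comp_neg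
  -- Both functions are locally integrable, so testing with smooth compactly supported ψ suffices.
  -- The L² transform is tested as a tempered distribution, the L¹ transform by moving the Fourier
  -- integral onto the test function.
  refine ae_eq_of_integral_contDiff_smul_eq
    ((Lp.memLp _).locallyIntegrable (by norm_num)) hcont.locallyIntegrable fun ψ hψ hψc => ?_
  have hg₁ : HasCompactSupport (Complex.ofRealCLM ∘ ψ) := hψc.comp_left rfl
  have hg₂ : ContDiff ℝ (⊤ : ℕ∞) (Complex.ofRealCLM ∘ ψ) :=
    Complex.ofRealCLM.contDiff.comp hψ
  set η : 𝓢(ℝ, ℂ) := hg₁.toSchwartzMap hg₂ with hη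
  have hη' : ∀ x, η x = (ψ x : ℂ) := fun x => rfl
  have h1 : ∫ x, ψ x • (𝓕⁻ h : Lp ℂ 2 (volume : Measure ℝ)) x = ∫ x, (𝓕⁻ η) x • h x := by
    have := congrArg (fun D : 𝓢'(ℝ, ℂ) => D η) (Lp.fourierInv_toTemperedDistribution_eq h)
    simp only [TemperedDistribution.fourierInv_apply, Lp.toTemperedDistribution_apply] at this
    rw [this]
    simp [hη']
  have h2 : ∫ x, (𝓕⁻ η) x • h x = ∫ x, η x • 𝓕⁻ (h : ℝ → ℂ) x := by
    rw [SchwartzMap.fourierInv_coe, Real.fourierInv_eq_fourier_comp_neg (h : ℝ → ℂ)]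
    have e : (fun x => 𝓕⁻ (η : ℝ → ℂ) x • h x) = fun x => 𝓕 (η : ℝ → ℂ) (-x) • h (- -x) := by
      ext x
      rw [Real.fourierInv_eq_fourier_neg, neg_neg]
    rw [e, integral_neg_eq_self (fun x => 𝓕 (η : ℝ → ℂ) x • h (-x))]
    have := VectorFourier.integral_fourierIntegral_smul_eq_flip (L := innerₗ ℝ) (μ := volume)
      (ν := volume) Real.continuous_fourierChar continuous_inner
      (η.integrable (μ := volume)) hh.comp_neg
    rw [flip_innerₗ] at this
    exact this
  rw [h1, h2]
  simp [hη']

/-- The Fourier transform of a function from that of its Bessel potential. -/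
theorem fourier_ae_eq_of_besselPotential_eq {s : ℝ} (hs : 0 ≤ s)
    {f g : Lp ℂ 2 (volume : Measure ℝ)}
    (h : TemperedDistribution.besselPotential ℝ ℂ s (f : 𝓢'(ℝ, ℂ)) = (g : 𝓢'(ℝ, ℂ))) :
    ((𝓕 f : Lp ℂ 2 (volume : Measure ℝ)) : ℝ → ℂ) =ᵐ[volume]
      fun ξ => (((1 + ‖ξ‖ ^ 2) ^ (-s / 2) : ℝ) : ℂ) * (𝓕 g : Lp ℂ 2 (volume : Measure ℝ)) ξ := by
  have hm : Function.HasTemperateGrowth (fun ξ : ℝ => (((1 + ‖ξ‖ ^ 2) ^ (-s / 2) : ℝ) : ℂ)) := by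
    fun_prop
  have hm' : Function.HasTemperateGrowth (fun ξ : ℝ => (((1 + ‖ξ‖ ^ 2) ^ (s / 2) : ℝ) : ℂ)) := by
    fun_prop
  have hmem : MemLp (fun ξ : ℝ => (((1 + ‖ξ‖ ^ 2) ^ (-s / 2) : ℝ) : ℂ)) ∞ volume := by
    refine memLp_top_of_bound hm.1.continuous.aestronglyMeasurable 1
      (Filter.Eventually.of_forall fun ξ => ?_)
    rw [Complex.norm_real, Real.norm_eq_abs, abs_of_nonneg (by positivity)]
    exact Real.rpow_le_one_of_one_le_of_nonpos (le_add_of_nonneg_right (by positivity)) (by linarith)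
  have h1 : TemperedDistribution.smulLeftCLM ℂ
      (fun ξ : ℝ => (((1 + ‖ξ‖ ^ 2) ^ (s / 2) : ℝ) : ℂ))
      ((𝓕 f : Lp ℂ 2 (volume : Measure ℝ)) : 𝓢'(ℝ, ℂ)) =
      ((𝓕 g : Lp ℂ 2 (volume : Measure ℝ)) : 𝓢'(ℝ, ℂ)) := by
    have := congrArg (fun D : 𝓢'(ℝ, ℂ) => 𝓕 D) h
    beta_reduce at this
    rw [TemperedDistribution.fourier_besselPotential_eq_smulLeftCLM_fourier_apply,
      Lp.fourier_toTemperedDistribution_eq, Lp.fourier_toTemperedDistribution_eq] at this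
    exact this
  -- The inverse symbol is bounded by 1 because s ≥ 0, so multiplying by it stays in L²; injectivity
  -- of L² into tempered distributions then identifies the functions.
  have h2 : ((𝓕 f : Lp ℂ 2 (volume : Measure ℝ)) : 𝓢'(ℝ, ℂ)) =
      (((hmem.toLp _) • (𝓕 g : Lp ℂ 2 (volume : Measure ℝ)) : Lp ℂ 2 (volume : Measure ℝ)) :
        𝓢'(ℝ, ℂ)) := by
    rw [Lp.toTemperedDistribution_smul_eq hm, ← h1,
      TemperedDistribution.smulLeftCLM_smulLeftCLM_apply hm' hm]
    have e : ((fun ξ : ℝ => (((1 + ‖ξ‖ ^ 2) ^ (s / 2) : ℝ) : ℂ)) *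
        fun ξ : ℝ => (((1 + ‖ξ‖ ^ 2) ^ (-s / 2) : ℝ) : ℂ)) = fun _ => 1 := by
      ext ξ
      rw [Pi.mul_apply, ← Complex.ofReal_mul, ← Real.rpow_add (by positivity)]
      ring_nf
      simp
    rw [e, TemperedDistribution.smulLeftCLM_const, one_smul]
  have h3 : (𝓕 f : Lp ℂ 2 (volume : Measure ℝ)) =
      (hmem.toLp _) • (𝓕 g : Lp ℂ 2 (volume : Measure ℝ)) :=
    LinearMap.ker_eq_bot.1 (Lp.ker_toTemperedDistributionCLM_eq_bot (F := ℂ)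
      (μ := (volume : Measure ℝ)) (p := 2)) h2
  rw [h3]
  filter_upwards [Lp.coeFn_lpSMul (r := 2) (hmem.toLp _) (𝓕 g : Lp ℂ 2 (volume : Measure ℝ)),
    hmem.coeFn_toLp] with ξ h4 h5
  rw [h4, Pi.smul_apply', h5, smul_eq_mul]

/-- The inverse Fourier integral of `n` times the Fourier transform of the `L²` function `g`. -/
noncomputable def multiplierRep (n : ℝ → ℂ) (g : Lp ℂ 2 (volume : Measure ℝ)) (x : ℝ) : ℂ :=
  𝓕⁻ (fun ξ => n ξ * (𝓕 g : Lp ℂ 2 (volume : Measure ℝ)) ξ) x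

section multiplierRep

variable {n : ℝ → ℂ}

theorem integrable_mul_fourier (hn : MemLp n 2 volume) (g : Lp ℂ 2 (volume : Measure ℝ)) :
    Integrable (fun ξ => n ξ * (𝓕 g : Lp ℂ 2 (volume : Measure ℝ)) ξ) :=
  hn.integrable_mul (Lp.memLp _)

theorem continuous_multiplierRep (hn : MemLp n 2 volume) (g : Lp ℂ 2 (volume : Measure ℝ)) :
    Continuous (multiplierRep n g) := by
  have h := (integrable_mul_fourier hn g).comp_neg
  have : multiplierRep n g =
      𝓕⁻ (fun ξ => n ξ * (𝓕 g : Lp ℂ 2 (volume : Measure ℝ)) ξ) := rfl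
  rw [this, Real.fourierInv_eq_fourier_comp_neg]
  exact VectorFourier.fourierIntegral_continuous Real.continuous_fourierChar continuous_inner h

theorem multiplierRep_sub (hn : MemLp n 2 volume) (g g' : Lp ℂ 2 (volume : Measure ℝ)) (x : ℝ) :
    multiplierRep n (g - g') x = multiplierRep n g x - multiplierRep n g' x := by
  have h : (fun ξ => n ξ * (𝓕 (g - g') : Lp ℂ 2 (volume : Measure ℝ)) ξ) =ᵐ[volume]
      fun ξ => n ξ * (𝓕 g : Lp ℂ 2 (volume : Measure ℝ)) ξ -
        n ξ * (𝓕 g' : Lp ℂ 2 (volume : Measure ℝ)) ξ := by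
    rw [sub_eq_add_neg, FourierTransform.fourier_add, FourierTransform.fourier_neg,
      ← sub_eq_add_neg]
    filter_upwards [Lp.coeFn_sub (𝓕 g : Lp ℂ 2 (volume : Measure ℝ)) (𝓕 g')] with ξ hξ
    rw [hξ, Pi.sub_apply, mul_sub]
  rw [multiplierRep, multiplierRep, multiplierRep, Real.fourierInv_congr_ae h]
  simp only [Real.fourierInv_eq, smul_sub]
  rw [integral_sub]
  · have := (Real.fourierIntegral_convergent_iff (-x)).2 (integrable_mul_fourier hn g)
    simpa using this
  · have := (Real.fourierIntegral_convergent_iff (-x)).2 (integrable_mul_fourier hn g')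
    simpa using this

/-- Cauchy–Schwarz on the Fourier side and Plancherel. The bound is uniform in x, which turns L²
continuity in time into joint continuity. -/
theorem norm_multiplierRep_le (hn : MemLp n 2 volume) (g : Lp ℂ 2 (volume : Measure ℝ)) (x : ℝ) :
    ‖multiplierRep n g x‖ ≤ (eLpNorm n 2 volume).toReal * ‖g‖ := by
  have h1 : ‖multiplierRep n g x‖ ≤
      ∫ ξ, ‖n ξ * (𝓕 g : Lp ℂ 2 (volume : Measure ℝ)) ξ‖ := by
    rw [multiplierRep, Real.fourierInv_eq_fourier_neg]
    exact VectorFourier.norm_fourierIntegral_le_integral_norm _ _ _ _ _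
  refine h1.trans ?_
  rw [← Lp.norm_fourier_eq g, Lp.norm_def, ← ENNReal.toReal_mul,
    integral_norm_eq_lintegral_enorm (integrable_mul_fourier hn g).aestronglyMeasurable,
    ← eLpNorm_one_eq_lintegral_enorm]
  refine ENNReal.toReal_mono (ENNReal.mul_ne_top hn.eLpNorm_ne_top (Lp.eLpNorm_ne_top _)) ?_
  exact eLpNorm_smul_le_mul_eLpNorm (p := 2) (q := 2) (r := 1)
    (f := (𝓕 g : Lp ℂ 2 (volume : Measure ℝ))) (φ := n) (Lp.memLp _).1 hn.1

theorem continuous_uncurry_multiplierRep (hn : MemLp n 2 volume) {X : Type*} [TopologicalSpace X]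
    {G : X → Lp ℂ 2 (volume : Measure ℝ)} (hG : Continuous G) :
    Continuous (fun q : X × ℝ => multiplierRep n (G q.1) q.2) := by
  refine continuous_iff_continuousAt.2 fun q₀ => ?_
  have h1 : Filter.Tendsto (fun q : X × ℝ => (eLpNorm n 2 volume).toReal * ‖G q.1 - G q₀.1‖ +
      ‖multiplierRep n (G q₀.1) q.2 - multiplierRep n (G q₀.1) q₀.2‖) (nhds q₀) (nhds 0) := by
    have hc : Continuous (fun q : X × ℝ => (eLpNorm n 2 volume).toReal * ‖G q.1 - G q₀.1‖ +
      ‖multiplierRep n (G q₀.1) q.2 - multiplierRep n (G q₀.1) q₀.2‖) := by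
      have := continuous_multiplierRep hn (G q₀.1)
      fun_prop
    simpa using hc.tendsto q₀
  rw [ContinuousAt, tendsto_iff_norm_sub_tendsto_zero]
  refine squeeze_zero (fun _ => norm_nonneg _) (fun q => ?_) h1
  calc ‖multiplierRep n (G q.1) q.2 - multiplierRep n (G q₀.1) q₀.2‖
      = ‖multiplierRep n (G q.1 - G q₀.1) q.2 +
        (multiplierRep n (G q₀.1) q.2 - multiplierRep n (G q₀.1) q₀.2)‖ := by
        rw [multiplierRep_sub hn]; congr 1; ring
    _ ≤ _ := (norm_add_le _ _).trans (by gcongr; exact norm_multiplierRep_le hn _ _)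

/-- The symbol is used in two roles: in L² it makes the inverse Fourier integral converge, in L^∞ it
preserves L². The two readings give the same function. -/
theorem multiplierRep_ae_eq (hn : MemLp n 2 volume) (hn' : MemLp n ∞ volume)
    (g : Lp ℂ 2 (volume : Measure ℝ)) :
    ((𝓕⁻ ((hn'.toLp _) • (𝓕 g : Lp ℂ 2 (volume : Measure ℝ)) : Lp ℂ 2 (volume : Measure ℝ)) :
      Lp ℂ 2 (volume : Measure ℝ)) : ℝ → ℂ) =ᵐ[volume] multiplierRep n g := by
  have h : (((hn'.toLp _) • (𝓕 g : Lp ℂ 2 (volume : Measure ℝ)) : Lp ℂ 2 (volume : Measure ℝ)) :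
      ℝ → ℂ) =ᵐ[volume] fun ξ => n ξ * (𝓕 g : Lp ℂ 2 (volume : Measure ℝ)) ξ := by
    filter_upwards [Lp.coeFn_lpSMul (r := 2) (hn'.toLp _) (𝓕 g : Lp ℂ 2 (volume : Measure ℝ)),
      hn'.coeFn_toLp] with ξ h4 h5
    rw [h4, Pi.smul_apply', h5, smul_eq_mul]
  refine (fourierInv_coeFn_ae_eq _ ((integrable_mul_fourier hn g).congr h.symm)).trans ?_
  exact Filter.Eventually.of_forall fun x => Real.fourierInv_congr_ae h x

theorem eLpNorm_multiplierRep_le (hn : MemLp n 2 volume) (hn' : MemLp n ∞ volume)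
    (g : Lp ℂ 2 (volume : Measure ℝ)) :
    eLpNorm (multiplierRep n g) 2 volume ≤
      ENNReal.ofReal ((eLpNorm n ∞ volume).toReal * ‖g‖) := by
  rw [← eLpNorm_congr_ae (multiplierRep_ae_eq hn hn' g), ← Lp.enorm_def, ← ofReal_norm]
  refine ENNReal.ofReal_le_ofReal ?_
  have e : ‖(𝓕⁻ ((hn'.toLp _) • (𝓕 g : Lp ℂ 2 (volume : Measure ℝ)) : Lp ℂ 2 (volume : Measure ℝ)) :
      Lp ℂ 2 (volume : Measure ℝ))‖ =
      ‖((hn'.toLp _) • (𝓕 g : Lp ℂ 2 (volume : Measure ℝ)) : Lp ℂ 2 (volume : Measure ℝ))‖ := by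
    rw [← Lp.norm_fourier_eq, FourierTransform.fourier_fourierInv_eq]
  rw [e]
  refine (Lp.norm_smul_le _ _).trans ?_
  rw [Lp.norm_toLp, Lp.norm_fourier_eq]

/-- Differentiation under the Fourier integral is legitimate because n' in L² makes ξ times the
integrand integrable. -/
theorem hasDerivAt_multiplierRep {n' : ℝ → ℂ} (hn : MemLp n 2 volume) (hn' : MemLp n' 2 volume)
    (h : ∀ ξ : ℝ, n' ξ = 2 * Real.pi * Complex.I * ξ * n ξ) (g : Lp ℂ 2 (volume : Measure ℝ))
    (x : ℝ) : HasDerivAt (multiplierRep n g) (multiplierRep n' g x) x := by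
  set H : ℝ → ℂ := fun ξ => n ξ * (𝓕 g : Lp ℂ 2 (volume : Measure ℝ)) ξ with hH
  have hint := integrable_mul_fourier hn g
  have hint' := integrable_mul_fourier hn' g
  have hint2 : Integrable (fun ξ : ℝ => ξ • H ξ) := by
    refine (hint'.const_mul (2 * Real.pi * Complex.I)⁻¹).congr
      (Filter.Eventually.of_forall fun ξ => ?_)
    simp only [hH, h, Complex.real_smul]
    field_simp
  have h1 := (Real.hasDerivAt_fourier hint hint2 (-x)).scomp x (hasDerivAt_neg x)
  have e : multiplierRep n g = 𝓕 H ∘ fun x => -x := by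
    ext y
    rw [multiplierRep, Real.fourierInv_eq_fourier_neg]
    rfl
  rw [e]
  refine h1.congr_deriv ?_
  rw [multiplierRep, Real.fourierInv_eq_fourier_neg, Real.fourier_eq, Real.fourier_eq,
    ← integral_smul]
  congr 1 with ξ
  simp only [h, smul_eq_mul, Circle.smul_def, neg_smul, one_smul]
  ring

end multiplierRep

/-- The symbol of `∂^k (1 - (2π)⁻² ∂²)^{-s/2}`. -/
noncomputable def derivBesselSymbol (s : ℝ) (k : ℕ) (ξ : ℝ) : ℂ :=
  (2 * Real.pi * Complex.I * ξ) ^ k * (((1 + ‖ξ‖ ^ 2) ^ (-s / 2) : ℝ) : ℂ)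

theorem continuous_derivBesselSymbol (s : ℝ) (k : ℕ) : Continuous (derivBesselSymbol s k) := by
  have hm : Function.HasTemperateGrowth (fun ξ : ℝ => (((1 + ‖ξ‖ ^ 2) ^ (-s / 2) : ℝ) : ℂ)) := by
    fun_prop
  have := hm.1.continuous
  unfold derivBesselSymbol
  fun_prop

/-- The base 2π(1 + ξ²)^{1/2} is at least 1, so the case k = 2 dominates the lower orders. -/
theorem norm_derivBesselSymbol_le (s : ℝ) {k : ℕ} (hk : k ≤ 2) (ξ : ℝ) :
    ‖derivBesselSymbol s k ξ‖ ≤ (2 * Real.pi) ^ 2 * (1 + ‖ξ‖ ^ 2) ^ (1 - s / 2) := by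
  have h0 : (0 : ℝ) < 1 + ‖ξ‖ ^ 2 := by positivity
  have h1 : ‖(2 * Real.pi * Complex.I * ξ : ℂ)‖ = 2 * Real.pi * ‖ξ‖ := by
    simp [abs_of_pos Real.pi_pos]
  have h2 : 2 * Real.pi * ‖ξ‖ ≤ 2 * Real.pi * (1 + ‖ξ‖ ^ 2) ^ (1 / 2 : ℝ) := by
    gcongr
    rw [← Real.sqrt_eq_rpow]
    exact Real.le_sqrt_of_sq_le (by linarith)
  have h3 : 1 ≤ 2 * Real.pi * (1 + ‖ξ‖ ^ 2) ^ (1 / 2 : ℝ) := by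
    have h4 : (1 : ℝ) ≤ (1 + ‖ξ‖ ^ 2) ^ (1 / 2 : ℝ) :=
      Real.one_le_rpow (le_add_of_nonneg_right (by positivity)) (by norm_num)
    nlinarith [Real.pi_gt_three]
  rw [derivBesselSymbol, norm_mul, norm_pow, h1, Complex.norm_real,
    Real.norm_of_nonneg (by positivity : 0 ≤ (1 + ‖ξ‖ ^ 2) ^ (-s / 2))]
  calc (2 * Real.pi * ‖ξ‖) ^ k * (1 + ‖ξ‖ ^ 2) ^ (-s / 2)
      ≤ (2 * Real.pi * (1 + ‖ξ‖ ^ 2) ^ (1 / 2 : ℝ)) ^ k * (1 + ‖ξ‖ ^ 2) ^ (-s / 2) := by gcongr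
    _ ≤ (2 * Real.pi * (1 + ‖ξ‖ ^ 2) ^ (1 / 2 : ℝ)) ^ 2 * (1 + ‖ξ‖ ^ 2) ^ (-s / 2) := by
        gcongr
    _ = (2 * Real.pi) ^ 2 * (1 + ‖ξ‖ ^ 2) ^ (1 - s / 2) := by
        rw [mul_pow, mul_assoc, ← Real.rpow_natCast ((1 + ‖ξ‖ ^ 2) ^ (1 / 2 : ℝ)),
          ← Real.rpow_mul h0.le, ← Real.rpow_add h0]
        congr 2
        push_cast
        ring

/-- The squared majorant is a multiple of (1 + ξ²)^{2 - s}, integrable on the line exactly when 2(s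
- 2) > 1: this is the threshold s > 5/2. -/
theorem memLp_two_derivBesselSymbol {s : ℝ} (hs : 5 / 2 < s) {k : ℕ} (hk : k ≤ 2) :
    MemLp (derivBesselSymbol s k) 2 volume := by
  have h1 : MemLp (fun ξ : ℝ => (1 + ‖ξ‖ ^ 2) ^ (1 - s / 2)) 2 volume := by
    have hc : Continuous (fun ξ : ℝ => (1 + ‖ξ‖ ^ 2) ^ (1 - s / 2)) :=
      (Function.hasTemperateGrowth_one_add_norm_sq_rpow ℝ (1 - s / 2)).1.continuous
    rw [memLp_two_iff_integrable_sq hc.aestronglyMeasurable]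
    have hi := integrable_rpow_neg_one_add_norm_sq (E := ℝ) (μ := volume) (r := 2 * (s - 2))
      (by simp; linarith)
    refine hi.congr (Filter.Eventually.of_forall fun ξ => ?_)
    simp only
    rw [← Real.rpow_natCast ((1 + ‖ξ‖ ^ 2) ^ (1 - s / 2)), ← Real.rpow_mul (by positivity)]
    congr 1
    push_cast
    ring
  refine (h1.const_mul ((2 * Real.pi) ^ 2)).mono
    (continuous_derivBesselSymbol s k).aestronglyMeasurable (Filter.Eventually.of_forall fun ξ => ?_)
  refine (norm_derivBesselSymbol_le s hk ξ).trans (le_abs_self _)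

theorem memLp_top_derivBesselSymbol {s : ℝ} (hs : 5 / 2 < s) {k : ℕ} (hk : k ≤ 2) :
    MemLp (derivBesselSymbol s k) ∞ volume := by
  refine memLp_top_of_bound (continuous_derivBesselSymbol s k).aestronglyMeasurable
    ((2 * Real.pi) ^ 2) (Filter.Eventually.of_forall fun ξ => ?_)
  refine (norm_derivBesselSymbol_le s hk ξ).trans (mul_le_of_le_one_right (by positivity) ?_)
  exact Real.rpow_le_one_of_one_le_of_nonpos (le_add_of_nonneg_right (by positivity)) (by linarith)

/-- Sobolev embedding for `C([0,T]; H^s)`, `s > 5/2`: after freezing time outside `[0,T]`, the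
function and its first two space derivatives are jointly continuous, bounded, and bounded in `L²`
uniformly in time. -/
theorem ContinuousInSobolev.exists_derivatives {T s : ℝ} {u : ℝ → ℝ → ℝ} (hT : 0 ≤ T)
    (hs : 5 / 2 < s) (hu : ContinuousInSobolev T s u) (huc : ∀ t ∈ Icc 0 T, Continuous (u t)) :
    ∃ (W : ℕ → ℝ → ℝ → ℝ) (B : ℝ) (R : ℝ≥0∞), R ≠ ∞ ∧
      (∀ t x, W 0 t x = u (projIcc 0 T hT t : ℝ) x) ∧
      (∀ k < 2, ∀ t x, HasDerivAt (W k t) (W (k + 1) t x) x) ∧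
      (∀ k ≤ 2, Continuous (Function.uncurry (W k))) ∧
      (∀ k ≤ 2, ∀ t x, |W k t x| ≤ B) ∧
      (∀ k ≤ 2, ∀ t, eLpNorm (W k t) 2 volume ≤ R) := by
  obtain ⟨f, g, hf, hfg, hg⟩ := hu
  set G : ℝ → Lp ℂ 2 (volume : Measure ℝ) := fun t => g (projIcc 0 T hT t) with hG
  have hGc : Continuous G := by
    have := continuousOn_iff_continuous_domRestrict.1 hg
    exact this.comp continuous_projIcc
  obtain ⟨D, hD⟩ : ∃ D, ∀ t, ‖G t‖ ≤ D := by
    obtain ⟨D, hD⟩ := isCompact_Icc.exists_bound_of_continuousOn hg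
    exact ⟨D, fun t => hD _ (projIcc 0 T hT t).2⟩
  set n := derivBesselSymbol s with hn
  have hn2 : ∀ k ≤ 2, MemLp (n k) 2 volume := fun k hk => memLp_two_derivBesselSymbol hs hk
  have hni : ∀ k ≤ 2, MemLp (n k) ∞ volume := fun k hk => memLp_top_derivBesselSymbol hs hk
  -- Summing over the three symbols gives one constant for all orders of derivative.
  set N : ℝ := ∑ k ∈ Finset.range 3, (eLpNorm (n k) 2 volume).toReal with hN
  set N' : ℝ := ∑ k ∈ Finset.range 3, (eLpNorm (n k) ∞ volume).toReal with hN'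
  refine ⟨fun k t x => (multiplierRep (n k) (G t) x).re, N * D, ENNReal.ofReal (N' * D),
    ENNReal.ofReal_ne_top, ?_, ?_, ?_, ?_, ?_⟩
  · intro t x
    set τ : ℝ := (projIcc 0 T hT t : ℝ) with hτ
    have hτm : τ ∈ Icc 0 T := (projIcc 0 T hT t).2
    have h1 : (f τ : ℝ → ℂ) =ᵐ[volume] multiplierRep (n 0) (G t) := by
      refine Filter.EventuallyEq.trans ?_ (multiplierRep_ae_eq (hn2 0 (by norm_num))
        (hni 0 (by norm_num)) (G t))
      have h2 : (𝓕 (f τ) : Lp ℂ 2 (volume : Measure ℝ)) =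
          ((hni 0 (by norm_num)).toLp _) • (𝓕 (G t) : Lp ℂ 2 (volume : Measure ℝ)) := by
        refine Lp.ext ?_
        filter_upwards [fourier_ae_eq_of_besselPotential_eq (by linarith) (hfg τ hτm),
          Lp.coeFn_lpSMul (r := 2) ((hni 0 (by norm_num)).toLp _)
            (𝓕 (G t) : Lp ℂ 2 (volume : Measure ℝ)), (hni 0 (by norm_num)).coeFn_toLp]
          with ξ h4 h5 h6
        have e : G t = g τ := rfl
        rw [h4, h5, Pi.smul_apply', h6, smul_eq_mul, e]
        simp [hn, derivBesselSymbol]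
      rw [← h2, FourierTransform.fourierInv_fourier_eq]
    -- Two continuous functions that agree almost everywhere agree everywhere; this ties the Fourier
    -- representative to u itself.
    have h3 : (fun x => ((u τ x : ℝ) : ℂ)) = multiplierRep (n 0) (G t) := by
      refine (Continuous.ae_eq_iff_eq volume
        (Complex.continuous_ofReal.comp (huc τ hτm))
        (continuous_multiplierRep (hn2 0 (by norm_num)) _)).1 ?_
      exact (Filter.EventuallyEq.symm (hf τ hτm)).trans h1
    have h4 := congrFun h3 x
    simp only at h4 ⊢
    rw [← h4, Complex.ofReal_re]
  · intro k hk t x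
    have h := hasDerivAt_multiplierRep (hn2 k hk.le) (hn2 (k + 1) hk)
      (fun ξ => by simp only [hn, derivBesselSymbol, pow_succ]; ring) (G t) x
    exact Complex.reCLM.hasFDerivAt.comp_hasDerivAt x h
  · intro k hk
    exact Complex.continuous_re.comp (continuous_uncurry_multiplierRep (hn2 k hk) hGc)
  · intro k hk t x
    refine (Complex.abs_re_le_norm _).trans ((norm_multiplierRep_le (hn2 k hk) _ _).trans ?_)
    refine mul_le_mul ?_ (hD t) (norm_nonneg _)
      (Finset.sum_nonneg fun _ _ => ENNReal.toReal_nonneg)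
    exact Finset.single_le_sum (f := fun k => (eLpNorm (n k) 2 volume).toReal)
      (fun _ _ => ENNReal.toReal_nonneg) (Finset.mem_range.2 (by omega))
  · intro k hk t
    refine (eLpNorm_mono (g := multiplierRep (n k) (G t)) fun x => ?_).trans
      ((eLpNorm_multiplierRep_le (hn2 k hk) (hni k hk) _).trans (ENNReal.ofReal_le_ofReal ?_))
    · exact Complex.abs_re_le_norm _
    refine mul_le_mul ?_ (hD t) (norm_nonneg _)
      (Finset.sum_nonneg fun _ _ => ENNReal.toReal_nonneg)
    exact Finset.single_le_sum (f := fun k => (eLpNorm (n k) ∞ volume).toReal)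
      (fun _ _ => ENNReal.toReal_nonneg) (Finset.mem_range.2 (by omega))

end sobolev

/-! ### The nonlocal evolution equation -/

/-- A family `W 0, W 1, W 2` of jointly continuous functions of `(t, x)`, bounded by `B`, in which
each one is the space derivative of the previous one. -/
structure IsRegularFamily (W : ℕ → ℝ → ℝ → ℝ) (B : ℝ) : Prop where
  hasDerivAt : ∀ k < 2, ∀ t x, HasDerivAt (W k t) (W (k + 1) t x) x
  continuous : ∀ k ≤ 2, Continuous (Function.uncurry (W k))
  abs_le : ∀ k ≤ 2, ∀ t x, |W k t x| ≤ B

/-- `(2u - u_x)²`. -/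
def flux (W : ℕ → ℝ → ℝ → ℝ) (t x : ℝ) : ℝ := (2 * W 0 t x - W 1 t x) ^ 2

/-- The space derivative of the flux. -/
def fluxDeriv (W : ℕ → ℝ → ℝ → ℝ) (t x : ℝ) : ℝ :=
  2 * (2 * W 0 t x - W 1 t x) * (2 * W 1 t x - W 2 t x)

/-- The right-hand side of the evolution equation `u_t = …` in nonlocal form. -/
noncomputable def evolutionRHS (W : ℕ → ℝ → ℝ → ℝ) (t x : ℝ) : ℝ :=
  -flux W t x + (3 * rightExp (flux W t) x - leftExp (flux W t) x) / 2

namespace IsRegularFamily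

variable {W : ℕ → ℝ → ℝ → ℝ} {B : ℝ}

theorem bound_nonneg (h : IsRegularFamily W B) : 0 ≤ B :=
  (abs_nonneg _).trans (h.abs_le 0 (by norm_num) 0 0)

theorem continuous_slice (h : IsRegularFamily W B) {k : ℕ} (hk : k ≤ 2) (t : ℝ) :
    Continuous (W k t) := (h.continuous k hk).comp (Continuous.prodMk_right t)

theorem hasDerivAt_flux (h : IsRegularFamily W B) (t x : ℝ) :
    HasDerivAt (flux W t) (fluxDeriv W t x) x := by
  have := (((h.hasDerivAt 0 (by norm_num) t x).const_mul 2).sub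
    (h.hasDerivAt 1 (by norm_num) t x)).pow 2
  refine this.congr_deriv ?_
  simp [fluxDeriv]

theorem continuous_flux (h : IsRegularFamily W B) : Continuous (Function.uncurry (flux W)) := by
  have h0 := h.continuous 0 (by norm_num)
  have h1 := h.continuous 1 (by norm_num)
  exact ((continuous_const.mul h0).sub h1).pow 2

theorem continuous_fluxDeriv (h : IsRegularFamily W B) :
    Continuous (Function.uncurry (fluxDeriv W)) := by
  have h0 := h.continuous 0 (by norm_num)
  have h1 := h.continuous 1 (by norm_num)
  have h2 := h.continuous 2 le_rfl
  exact (continuous_const.mul ((continuous_const.mul h0).sub h1)).mul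
    ((continuous_const.mul h1).sub h2)

theorem abs_two_mul_sub_le (h : IsRegularFamily W B) {k : ℕ} (hk : k < 2) (t x : ℝ) :
    |2 * W k t x - W (k + 1) t x| ≤ 3 * B := by
  have h0 := _root_.abs_le.1 (h.abs_le k hk.le t x)
  have h1 := _root_.abs_le.1 (h.abs_le (k + 1) hk t x)
  exact _root_.abs_le.2 ⟨by linarith, by linarith⟩

theorem abs_flux_le (h : IsRegularFamily W B) (t x : ℝ) : |flux W t x| ≤ 9 * B ^ 2 := by
  have := h.abs_two_mul_sub_le (k := 0) (by norm_num) t x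
  rw [flux, abs_pow]
  calc |2 * W 0 t x - W 1 t x| ^ 2 ≤ (3 * B) ^ 2 := by gcongr
    _ = 9 * B ^ 2 := by ring

theorem abs_fluxDeriv_le (h : IsRegularFamily W B) (t x : ℝ) :
    |fluxDeriv W t x| ≤ 18 * B ^ 2 := by
  have h0 := h.abs_two_mul_sub_le (k := 0) (by norm_num) t x
  have h1 := h.abs_two_mul_sub_le (k := 1) (by norm_num) t x
  rw [fluxDeriv, abs_mul, abs_mul, abs_two]
  calc 2 * |2 * W 0 t x - W 1 t x| * |2 * W 1 t x - W 2 t x| ≤ 2 * (3 * B) * (3 * B) := by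
        have := h.bound_nonneg
        gcongr
    _ = 18 * B ^ 2 := by ring

theorem continuous_leftExp_flux (h : IsRegularFamily W B) :
    Continuous (Function.uncurry fun t x => leftExp (flux W t) x) :=
  continuous_uncurry_leftExp h.continuous_flux h.abs_flux_le

theorem continuous_rightExp_flux (h : IsRegularFamily W B) :
    Continuous (Function.uncurry fun t x => rightExp (flux W t) x) :=
  continuous_uncurry_rightExp h.continuous_flux h.abs_flux_le

theorem continuous_evolutionRHS (h : IsRegularFamily W B) :
    Continuous (Function.uncurry (evolutionRHS W)) :=
  h.continuous_flux.neg.add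
    (((continuous_const.mul h.continuous_rightExp_flux).sub h.continuous_leftExp_flux).div_const 2)

theorem abs_evolutionRHS_le (h : IsRegularFamily W B) (t x : ℝ) :
    |evolutionRHS W t x| ≤ 27 * B ^ 2 := by
  have h1 := _root_.abs_le.1 (h.abs_flux_le t x)
  have h2 := _root_.abs_le.1 (abs_leftExp_le (h.abs_flux_le t) x)
  have h3 := _root_.abs_le.1 (abs_rightExp_le (h.abs_flux_le t) x)
  rw [evolutionRHS]
  exact _root_.abs_le.2 ⟨by linarith, by linarith⟩

end IsRegularFamily

theorem continuous_integral_mul_schwartz {V : ℝ → ℝ → ℝ} {B : ℝ}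
    (hV : Continuous (Function.uncurry V)) (hB : ∀ t x, |V t x| ≤ B) (η : 𝓢(ℝ, ℝ)) :
    Continuous fun t => ∫ x, V t x * η x := by
  refine continuous_of_dominated (bound := fun x => B * ‖η x‖) (fun t => ?_) (fun t => ?_) ?_ ?_
  · have : Continuous (V t) := hV.comp (Continuous.prodMk_right t)
    exact (this.mul η.continuous).aestronglyMeasurable
  · refine Filter.Eventually.of_forall fun x => ?_
    rw [norm_mul, Real.norm_eq_abs]
    gcongr
    exact hB t x
  · exact η.integrable.norm.const_mul B
  · refine Filter.Eventually.of_forall fun x => ?_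
    exact (hV.comp (Continuous.prodMk_left x)).mul continuous_const

/-- A strong solution satisfies the nonlocal evolution equation pointwise, integrated in time. -/
theorem IsStrongSolution.sub_eq_integral_evolutionRHS {T s : ℝ} {u₀ : ℝ → ℝ} {u : ℝ → ℝ → ℝ}
    (hu : IsStrongSolution T s u₀ u) {W : ℕ → ℝ → ℝ → ℝ} {B : ℝ} (hW : IsRegularFamily W B)
    (hWu : ∀ t ∈ Icc 0 T, W 0 t = u t) {t₁ t₂ : ℝ} (h0 : 0 ≤ t₁) (h12 : t₁ ≤ t₂) (h2T : t₂ ≤ T)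
    (x : ℝ) : W 0 t₂ x - W 0 t₁ x = ∫ τ in t₁..t₂, evolutionRHS W τ x := by
  set E := evolutionRHS W with hE
  have hEc := hW.continuous_evolutionRHS
  have hEB := hW.abs_evolutionRHS_le
  have hW0c := hW.continuous 0 (by norm_num)
  have hW0B := hW.abs_le 0 (by norm_num)
  -- Testing the equation with ψ such that ψ - ψ'' = η gives d/dt ⟨u, η⟩ = ⟨E, η⟩ in the open
  -- interval. Continuity of the pairings up to the endpoints permits integration over [t₁, t₂], and
  -- Fubini exchanges the integrals.
  have key : ∀ η : 𝓢(ℝ, ℝ), (∫ x, W 0 t₂ x * η x) - (∫ x, W 0 t₁ x * η x) =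
      ∫ x, (∫ τ in t₁..t₂, E τ x) * η x := by
    intro η
    obtain ⟨ψ, hψ⟩ := η.exists_sub_iteratedDeriv_two_eq
    have hder : ∀ t ∈ Ioo t₁ t₂, HasDerivAt (fun τ => ∫ x, W 0 τ x * η x) (∫ x, E t x * η x) t := by
      intro t ht
      have htT : t ∈ Ioo 0 T := ⟨h0.trans_lt ht.1, ht.2.trans_le h2T⟩
      have h := hu.equation t htT ψ
      have hut : u t = W 0 t := (hWu t ⟨htT.1.le, htT.2.le⟩).symm
      have hdu : deriv (u t) = W 1 t := by
        rw [hut]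
        exact funext fun x => (hW.hasDerivAt 0 (by norm_num) t x).deriv
      have h1 : ∫ x, (2 * u t x - deriv (u t) x) ^ 2 * (iteratedDeriv 2 ψ x - 2 * deriv ψ x) =
          ∫ x, E t x * η x := by
        have := integral_nonlocal_mul_sub_deriv_two (hW.hasDerivAt_flux t)
          (hW.continuous_fluxDeriv.comp (Continuous.prodMk_right t)) (hW.abs_flux_le t)
          (hW.abs_fluxDeriv_le t) ψ
        rw [hdu, hut]
        simp only [hψ] at this
        exact this.symm
      rw [h1] at h
      refine h.congr_of_eventuallyEq ?_
      filter_upwards [isOpen_Ioo.mem_nhds htT] with τ hτ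
      simp only [hψ, hWu τ ⟨hτ.1.le, hτ.2.le⟩]
    have h3 := intervalIntegral.integral_eq_sub_of_hasDerivAt_of_le h12
      (continuous_integral_mul_schwartz hW0c hW0B η).continuousOn hder
      ((continuous_integral_mul_schwartz hEc hEB η).intervalIntegrable _ _)
    rw [← h3, intervalIntegral.integral_of_le h12]
    rw [integral_integral_swap]
    · congr 1 with x
      rw [intervalIntegral.integral_of_le h12, integral_mul_const]
    · have hi : Integrable (fun q : ℝ × ℝ => (27 * B ^ 2) * ‖η q.2‖)
          ((volume.restrict (Ioc t₁ t₂)).prod volume) :=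
        (integrable_const (27 * B ^ 2)).mul_prod η.integrable.norm
      refine hi.mono' ?_ (Filter.Eventually.of_forall fun q => ?_)
      · exact (hEc.mul (η.continuous.comp continuous_snd)).aestronglyMeasurable
      · simp only [Function.uncurry]
        rw [norm_mul, Real.norm_eq_abs]
        gcongr
        exact hEB q.1 q.2
  have hIc : Continuous fun x => ∫ τ in t₁..t₂, E τ x :=
    intervalIntegral.continuous_parametric_intervalIntegral_of_continuous' (f := fun x τ => E τ x)
      (hEc.comp continuous_swap) t₁ t₂
  have hLc : Continuous fun x => W 0 t₂ x - W 0 t₁ x :=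
    (hW.continuous_slice (by norm_num) t₂).sub (hW.continuous_slice (by norm_num) t₁)
  refine congrFun ((Continuous.ae_eq_iff_eq volume hLc hIc).1 ?_) x
  refine ae_eq_of_integral_contDiff_smul_eq hLc.locallyIntegrable hIc.locallyIntegrable
    fun ψ hψ hψc => ?_
  have := key (hψc.toSchwartzMap hψ)
  rw [← integral_sub] at this
  · calc ∫ x, ψ x • (W 0 t₂ x - W 0 t₁ x) = ∫ x, W 0 t₂ x * ψ x - W 0 t₁ x * ψ x := by
          congr 1 with x
          rw [smul_eq_mul]; ring
      _ = ∫ x, (∫ τ in t₁..t₂, E τ x) * ψ x := this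
      _ = _ := by
          congr 1 with x
          rw [smul_eq_mul, mul_comm]
  · exact SchwartzMap.integrable_bounded_mul _ (hW.continuous_slice (by norm_num) t₂) (hW0B t₂)
  · exact SchwartzMap.integrable_bounded_mul _ (hW.continuous_slice (by norm_num) t₁) (hW0B t₁)

/-! ### Characteristics and the transport equation -/

/-- The flow with prescribed terminal value of a bounded field that is Lipschitz in space; it is
frozen outside `[t₁, t₂]`. -/
theorem exists_terminal_flow_of_lipschitz {f : ℝ → ℝ → ℝ} {L K : NNReal}
    (hlip : ∀ t, LipschitzWith K (f t)) (hcont : ∀ x, Continuous fun t => f t x)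
    (hL : ∀ t x, |f t x| ≤ L) {t₁ t₂ : ℝ} (h12 : t₁ ≤ t₂) :
    ∃ q : ℝ → ℝ → ℝ, Continuous (Function.uncurry q) ∧ (∀ x, q x t₂ = x) ∧
      (∀ x, ∀ τ ∈ Ioo t₁ t₂, HasDerivAt (q x) (f τ (q x τ)) τ) ∧
      (∀ x τ, |q x τ - x| ≤ L * (t₂ - t₁)) ∧
      (∀ x y τ, |q x τ - q y τ| ≤ Real.exp (K * (t₂ - t₁)) * |x - y|) ∧
      ∀ x y τ, |x - y| ≤ Real.exp (K * (t₂ - t₁)) * |q x τ - q y τ| := by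
  have hδ : 0 ≤ t₂ - t₁ := sub_nonneg.2 h12
  have hex : ∀ x, ∃ a : ℝ → ℝ, a t₂ = x ∧
      ∀ t ∈ Icc t₁ t₂, HasDerivWithinAt a (f t (a t)) (Icc t₁ t₂) t := by
    intro x
    -- The field is bounded by L everywhere, so a ball of radius L(t₂ - t₁) contains the trajectory
    -- for the whole interval.
    have hpl : IsPicardLindelof f (tmin := t₁) (tmax := t₂) ⟨t₂, h12, le_rfl⟩ x
        (L * (t₂ - t₁).toNNReal) 0 L K :=
      { lipschitzOnWith := fun t _ => (hlip t).lipschitzOnWith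
        continuousOn := fun x _ => (hcont x).continuousOn
        norm_le := fun t _ x _ => hL t x
        mul_max_le := by simp [Real.coe_toNNReal _ hδ, hδ] }
    exact hpl.exists_eq_forall_mem_Icc_hasDerivWithinAt (Metric.mem_closedBall_self le_rfl)
  choose a ha had using hex
  have hac : ∀ x, ContinuousOn (a x) (Icc t₁ t₂) := fun x t ht => (had x t ht).continuousWithinAt
  have haR : ∀ x, ∀ t ∈ Ico t₁ t₂, HasDerivWithinAt (a x) (f t (a x t)) (Ici t) t :=
    fun x t ht => (had x t ⟨ht.1, ht.2.le⟩).mono_of_mem_nhdsWithin (Icc_mem_nhdsGE_of_mem ht)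
  -- Gronwall run forward from τ to the terminal time, where the curves are at x and y; the next
  -- estimate runs it backward in time.
  have hfwd : ∀ x y, ∀ τ ∈ Icc t₁ t₂,
      |x - y| ≤ Real.exp (K * (t₂ - t₁)) * |a x τ - a y τ| := by
    intro x y τ hτ
    have hsub : Icc τ t₂ ⊆ Icc t₁ t₂ := Icc_subset_Icc_left hτ.1
    have h := dist_le_of_trajectories_ODE hlip ((hac x).mono hsub)
      (fun t ht => haR x t ⟨hτ.1.trans ht.1, ht.2⟩) ((hac y).mono hsub)
      (fun t ht => haR y t ⟨hτ.1.trans ht.1, ht.2⟩) le_rfl t₂ ⟨hτ.2, le_rfl⟩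
    rw [ha, ha, Real.dist_eq, Real.dist_eq, mul_comm] at h
    refine h.trans ?_
    gcongr
    exact hτ.1
  have hbwd : ∀ x y, ∀ τ ∈ Icc t₁ t₂,
      |a x τ - a y τ| ≤ Real.exp (K * (t₂ - t₁)) * |x - y| := by
    intro x y τ hτ
    have hrev : ∀ x, ContinuousOn (fun σ => a x (t₂ - σ)) (Icc 0 (t₂ - τ)) := fun x =>
      (hac x).comp (by fun_prop) fun σ hσ => ⟨by linarith [hσ.2, hτ.1], by linarith [hσ.1]⟩
    have hrevd : ∀ x, ∀ σ ∈ Ico 0 (t₂ - τ), HasDerivWithinAt (fun σ => a x (t₂ - σ))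
        (-f (t₂ - σ) (a x (t₂ - σ))) (Ici σ) σ := by
      intro x σ hσ
      have hm : t₂ - σ ∈ Icc t₁ t₂ := ⟨by linarith [hσ.2, hτ.1], by linarith [hσ.1]⟩
      have h1 := (had x _ hm).scomp (h := fun σ => t₂ - σ) (s := Icc 0 (t₂ - t₁)) σ
        (((hasDerivAt_id σ).const_sub t₂).hasDerivWithinAt)
        (fun σ hσ => ⟨by linarith [hσ.2], by linarith [hσ.1]⟩)
      have hnhds : Icc 0 (t₂ - t₁) ∈ nhdsWithin σ (Ici σ) :=
        Icc_mem_nhdsGE_of_mem ⟨hσ.1, by linarith [hσ.2, hτ.1]⟩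
      refine (h1.mono_of_mem_nhdsWithin hnhds).congr_deriv ?_
      simp
    have h := dist_le_of_trajectories_ODE (v := fun σ y => -f (t₂ - σ) y) (K := K)
      (fun σ => (hlip _).neg) (hrev x) (hrevd x) (hrev y) (hrevd y) le_rfl (t₂ - τ)
      ⟨by linarith [hτ.2], le_rfl⟩
    simp only [sub_zero, sub_sub_cancel] at h
    rw [ha, ha, Real.dist_eq, Real.dist_eq, mul_comm] at h
    refine h.trans ?_
    gcongr
    exact hτ.1
  have hproj : ∀ τ, (projIcc t₁ t₂ h12 τ : ℝ) ∈ Icc t₁ t₂ := fun τ => (projIcc t₁ t₂ h12 τ).2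
  have hprojeq : ∀ τ ∈ Icc t₁ t₂, (projIcc t₁ t₂ h12 τ : ℝ) = τ := fun τ hτ => by
    rw [projIcc_of_mem h12 hτ]
  refine ⟨fun x τ => a x (projIcc t₁ t₂ h12 τ), ?_, ?_, ?_, ?_, ?_, ?_⟩
  · refine continuous_prod_of_continuous_lipschitzWith _ (Real.exp (K * (t₂ - t₁))).toNNReal
      (fun x => ?_) fun τ => LipschitzWith.of_dist_le_mul fun x y => ?_
    · exact (continuousOn_iff_continuous_domRestrict.1 (hac x)).comp continuous_projIcc
    · rw [Real.coe_toNNReal _ (Real.exp_pos _).le]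
      exact hbwd x y _ (hproj τ)
  · intro x
    beta_reduce
    rw [hprojeq _ ⟨h12, le_rfl⟩, ha]
  · intro x τ hτ
    have h1 := (had x τ (Ioo_subset_Icc_self hτ)).hasDerivAt (Icc_mem_nhds hτ.1 hτ.2)
    simp only [hprojeq τ (Ioo_subset_Icc_self hτ)]
    refine h1.congr_of_eventuallyEq ?_
    filter_upwards [Icc_mem_nhds hτ.1 hτ.2] with σ hσ
    simp only [hprojeq σ hσ]
  · intro x τ
    have h1 := (convex_Icc t₁ t₂).norm_image_sub_le_of_norm_hasDerivWithin_le
      (fun t ht => had x t ht) (fun t _ => hL t (a x t)) (right_mem_Icc.2 h12) (hproj τ)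
    rw [ha, Real.norm_eq_abs, Real.norm_eq_abs] at h1
    refine h1.trans ?_
    gcongr
    rw [abs_sub_comm, abs_of_nonneg (sub_nonneg.2 (hproj τ).2)]
    linarith [(hproj τ).1]
  · exact fun x y τ => hbwd x y _ (hproj τ)
  · exact fun x y τ => hfwd x y _ (hproj τ)

/-- If the space derivative is bounded by a continuous function then increments over small
distances are, up to `ε`, bounded uniformly along a compact curve. -/
theorem eventually_abs_sub_le_of_hasDerivAt {g g' H : ℝ → ℝ → ℝ} {q : ℝ → ℝ} {t₁ t₂ ε : ℝ}
    (hε : 0 < ε) (hH : Continuous (Function.uncurry H)) (hq : Continuous q)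
    (hg : ∀ t x, HasDerivAt (g t) (g' t x) x) (hgH : ∀ t x, |g' t x| ≤ H t x) :
    ∀ᶠ ρ in nhds (0 : ℝ), ∀ τ ∈ Icc t₁ t₂, ∀ z, |z - q τ| ≤ ρ →
      |g τ z - g τ (q τ)| ≤ (H τ (q τ) + ε) * |z - q τ| := by
  -- Compactness of [t₁, t₂] makes the neighbourhood on which H varies by less than ε independent of
  -- τ.
  have hnear : ∀ᶠ σ in nhds (0 : ℝ), ∀ τ ∈ Icc t₁ t₂, H τ (q τ + σ) < H τ (q τ) + ε := by
    refine isCompact_Icc.eventually_forall_of_forall_eventually fun τ _ => ?_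
    have h1 : Continuous fun z : ℝ × ℝ => H z.2 (q z.2 + z.1) :=
      hH.comp (continuous_snd.prodMk ((hq.comp continuous_snd).add continuous_fst))
    have h2 : Continuous fun z : ℝ × ℝ => H z.2 (q z.2) + ε :=
      (hH.comp (continuous_snd.prodMk (hq.comp continuous_snd))).add continuous_const
    exact h1.continuousAt.eventually_lt h2.continuousAt (by simpa using hε)
  obtain ⟨ρ₀, hρ₀, hball⟩ := Metric.eventually_nhds_iff.1 hnear
  filter_upwards [gt_mem_nhds hρ₀] with ρ hρ τ hτ z hz
  refine (convex_uIcc (q τ) z).norm_image_sub_le_of_norm_hasDerivWithin_le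
    (fun w _ => (hg τ w).hasDerivWithinAt) (fun w hw => ?_) left_mem_uIcc right_mem_uIcc
  have hw' : |w - q τ| ≤ |z - q τ| := abs_sub_left_of_mem_uIcc hw
  have h3 := hball (y := w - q τ) (by rw [dist_zero_right, Real.norm_eq_abs]; linarith) τ hτ
  rw [add_sub_cancel] at h3
  exact (hgH τ w).trans h3.le

/-- Propagation of the space derivative of a solution of the transport equation
`∂_t r = c ∂_x r + g` along characteristics, without second derivatives of `r`. -/
theorem abs_deriv_le_along_characteristic {r r' rt c g g' H : ℝ → ℝ → ℝ} {q : ℝ → ℝ → ℝ}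
    {t₁ t₂ Λ : ℝ} (h12 : t₁ ≤ t₂) (hΛ : 0 ≤ Λ)
    (hrc : Continuous (Function.uncurry r)) (hr'c : Continuous (Function.uncurry r'))
    (hrtc : Continuous (Function.uncurry rt)) (hgc : Continuous (Function.uncurry g))
    (hHc : Continuous (Function.uncurry H)) (hr : ∀ t x, HasDerivAt (r t) (r' t x) x)
    (hrt : ∀ t ∈ Ioo t₁ t₂, ∀ x, HasDerivAt (fun τ => r τ x) (rt t x) t)
    (heq : ∀ t x, rt t x = c t x * r' t x + g t x)
    (hg : ∀ t x, HasDerivAt (g t) (g' t x) x) (hgH : ∀ t x, |g' t x| ≤ H t x)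
    (hqc : Continuous (Function.uncurry q)) (hq₂ : ∀ x, q x t₂ = x)
    (hqd : ∀ x, ∀ τ ∈ Ioo t₁ t₂, HasDerivAt (q x) (-c τ (q x τ)) τ)
    (hqΛ : ∀ x y τ, |q x τ - q y τ| ≤ Λ * |x - y|) (x : ℝ) :
    |r' t₂ x| ≤ Λ * (|r' t₁ (q x t₁)| + ∫ τ in t₁..t₂, H τ (q x τ)) := by
  have hqc' : ∀ x, Continuous (q x) := fun x => hqc.comp (Continuous.prodMk_right x)
  have along : ∀ {V : ℝ → ℝ → ℝ}, Continuous (Function.uncurry V) → ∀ x,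
      Continuous fun τ => V τ (q x τ) := fun hV x => hV.comp (continuous_id.prodMk (hqc' x))
  -- Along a characteristic the two terms c r' cancel. Continuity of both partial derivatives makes
  -- r jointly differentiable, as the chain rule requires.
  have hint : ∀ x, r t₂ x - r t₁ (q x t₁) = ∫ τ in t₁..t₂, g τ (q x τ) := by
    intro x
    have hd : ∀ τ ∈ Ioo t₁ t₂, HasDerivAt (fun τ => r τ (q x τ)) (g τ (q x τ)) τ := by
      intro τ hτ
      have hstrict := hasStrictFDerivAt_uncurry_coprod (𝕜 := ℝ) (u := (τ, q x τ)) (f := r)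
        (f₁ := fun t x => ContinuousLinearMap.toSpanSingleton ℝ (rt t x))
        (f₂ := fun t x => ContinuousLinearMap.toSpanSingleton ℝ (r' t x)) ?_ ?_ ?_ ?_
      · have h1 : HasDerivAt (fun τ => (τ, q x τ)) (1, -c τ (q x τ)) τ :=
          (hasDerivAt_id τ).prodMk (hqd x τ hτ)
        have h2 := hstrict.hasFDerivAt.comp_hasDerivAt τ h1
        refine h2.congr_deriv ?_
        simp [Function.HasUncurry.uncurry, heq]
      · have : ∀ᶠ v : ℝ × ℝ in nhds (τ, q x τ), v.1 ∈ Ioo t₁ t₂ :=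
          continuous_fst.continuousAt.eventually_mem (isOpen_Ioo.mem_nhds hτ)
        filter_upwards [this] with v hv
        exact (hrt v.1 hv v.2).hasFDerivAt
      · exact Filter.Eventually.of_forall fun v => (hr v.1 v.2).hasFDerivAt
      · exact ((ContinuousLinearMap.toSpanSingletonCLE (𝕜 := ℝ) (E := ℝ)).continuous.comp
          hrtc).continuousAt
      · exact ((ContinuousLinearMap.toSpanSingletonCLE (𝕜 := ℝ) (E := ℝ)).continuous.comp
          hr'c).continuousAt
    have := intervalIntegral.integral_eq_sub_of_hasDerivAt_of_le h12 (along hrc x).continuousOn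
      hd ((along hgc x).intervalIntegrable _ _)
    rw [this, hq₂]
  -- The integrated identity is subtracted for the curves ending at y and x, which stay within Λ|y -
  -- x| of each other. Only increments of g and of the initial slice appear, so a local Lipschitz
  -- constant at x results and bounds r'.
  have hε : ∀ ε > 0, |r' t₂ x| ≤ Λ * ((|r' t₁ (q x t₁)| + ε) +
      ((∫ τ in t₁..t₂, H τ (q x τ)) + (t₂ - t₁) * ε)) := by
    intro ε hε
    set A := Λ * ((|r' t₁ (q x t₁)| + ε) + ((∫ τ in t₁..t₂, H τ (q x τ)) + (t₂ - t₁) * ε)) with hA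
    have e1 := eventually_abs_sub_le_of_hasDerivAt (t₁ := t₁) (t₂ := t₂) hε
      (H := fun t x => |r' t x|) hr'c.abs (hqc' x) hr (fun _ _ => le_rfl)
    have e2 := eventually_abs_sub_le_of_hasDerivAt (t₁ := t₁) (t₂ := t₂) hε hHc (hqc' x) hg hgH
    have hcont : Filter.Tendsto (fun y => Λ * |y - x|) (nhds x) (nhds 0) := by
      have : Continuous fun y => Λ * |y - x| := by fun_prop
      simpa using this.tendsto x
    have hlip : ∀ᶠ y in nhds x, ‖r t₂ y - r t₂ x‖ ≤ A * ‖y - x‖ := by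
      filter_upwards [hcont.eventually (e1.and e2)] with y hy
      obtain ⟨hy1, hy2⟩ := hy
      have hb1 := hy1 t₁ ⟨le_rfl, h12⟩ (q y t₁) (hqΛ y x t₁)
      have hb2 : |∫ τ in t₁..t₂, (g τ (q y τ) - g τ (q x τ))| ≤
          ∫ τ in t₁..t₂, (H τ (q x τ) + ε) * (Λ * |y - x|) := by
        rw [← Real.norm_eq_abs]
        refine intervalIntegral.norm_integral_le_of_norm_le h12
          (Filter.Eventually.of_forall fun τ hτ => ?_)
          ((((along hHc x).add continuous_const).mul continuous_const).intervalIntegrable _ _)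
        refine (hy2 τ ⟨hτ.1.le, hτ.2⟩ (q y τ) (hqΛ y x τ)).trans ?_
        have : 0 ≤ H τ (q x τ) := (abs_nonneg _).trans (hgH _ _)
        gcongr
        exact hqΛ y x τ
      rw [intervalIntegral.integral_mul_const, intervalIntegral.integral_add
        ((along hHc x).intervalIntegrable _ _) intervalIntegrable_const,
        intervalIntegral.integral_const, smul_eq_mul] at hb2
      rw [intervalIntegral.integral_sub ((along hgc y).intervalIntegrable _ _)
        ((along hgc x).intervalIntegrable _ _), ← hint, ← hint] at hb2
      have hb3 : |r t₁ (q y t₁) - r t₁ (q x t₁)| ≤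
          (|r' t₁ (q x t₁)| + ε) * (Λ * |y - x|) := by
        refine hb1.trans ?_
        gcongr
        exact hqΛ y x t₁
      rw [Real.norm_eq_abs, Real.norm_eq_abs]
      calc |r t₂ y - r t₂ x|
          = |(r t₁ (q y t₁) - r t₁ (q x t₁)) +
            ((r t₂ y - r t₁ (q y t₁)) - (r t₂ x - r t₁ (q x t₁)))| := by congr 1; ring
        _ ≤ _ := abs_add_le _ _
        _ ≤ (|r' t₁ (q x t₁)| + ε) * (Λ * |y - x|) +
            ((∫ τ in t₁..t₂, H τ (q x τ)) + (t₂ - t₁) * ε) * (Λ * |y - x|) := add_le_add hb3 hb2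
        _ = A * |y - x| := by rw [hA]; ring
    have hI : 0 ≤ ∫ τ in t₁..t₂, H τ (q x τ) :=
      intervalIntegral.integral_nonneg h12 fun τ _ => (abs_nonneg _).trans (hgH _ _)
    have hA0 : 0 ≤ A := by positivity
    have := (hr t₂ x).le_of_lip' hA0 hlip
    rwa [Real.norm_eq_abs] at this
  refine le_of_forall_pos_le_add fun η hη => ?_
  -- The added 1 keeps the divisor positive even if Λ = 0.
  set k := Λ * (1 + (t₂ - t₁)) + 1 with hk
  have hk0 : 0 < k := by positivity
  refine (hε (η / k) (by positivity)).trans ?_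
  have : Λ * (1 + (t₂ - t₁)) * (η / k) ≤ η := by
    rw [← mul_div_assoc, div_le_iff₀ hk0, hk]
    nlinarith
  linarith

/-! ### Pointwise bounds by the linear majorant -/

/-- `|u| + |u_x| + |u_xx|`. -/
def pointSum (W : ℕ → ℝ → ℝ → ℝ) (t x : ℝ) : ℝ := |W 0 t x| + |W 1 t x| + |W 2 t x|

/-- The convolution of `|u| + |u_x| + |u_xx|` with `e^{-|x|}`. -/
noncomputable def pointConv (W : ℕ → ℝ → ℝ → ℝ) (t x : ℝ) : ℝ :=
  ∫ y, Real.exp (-|y|) * pointSum W t (x - y)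

/-- A common majorant of the forcing terms in the equations for `u`, `u_x`, `u_xx`. -/
noncomputable def forcingMajorant (W : ℕ → ℝ → ℝ → ℝ) (M t x : ℝ) : ℝ :=
  M * (54 * pointSum W t x + 12 * pointConv W t x)

/-- The space derivative of the right-hand side of the evolution equation. -/
noncomputable def evolutionRHSDeriv (W : ℕ → ℝ → ℝ → ℝ) (t x : ℝ) : ℝ :=
  -fluxDeriv W t x - 2 * flux W t x + (3 * rightExp (flux W t) x + leftExp (flux W t) x) / 2

/-- The coefficient of `u_xx` in the equation for `u_x`. -/
def transportCoeff (W : ℕ → ℝ → ℝ → ℝ) (t x : ℝ) : ℝ := 2 * (2 * W 0 t x - W 1 t x)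

/-- The part of the right-hand side of the equation for `u_x` that does not involve `u_xx`. -/
noncomputable def transportSource (W : ℕ → ℝ → ℝ → ℝ) (t x : ℝ) : ℝ :=
  -2 * (transportCoeff W t x * W 1 t x) - 2 * flux W t x +
    (3 * rightExp (flux W t) x + leftExp (flux W t) x) / 2

/-- The space derivative of the transport source. -/
noncomputable def transportSourceDeriv (W : ℕ → ℝ → ℝ → ℝ) (t x : ℝ) : ℝ :=
  -2 * (2 * (2 * W 1 t x - W 2 t x) * W 1 t x + transportCoeff W t x * W 2 t x)
    - 2 * fluxDeriv W t x - flux W t x + (3 * rightExp (flux W t) x - leftExp (flux W t) x) / 2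

/-- Since -F' = c u_xx - 2c u_x, all dependence on u_xx sits in the transport term. -/
theorem evolutionRHSDeriv_eq (W : ℕ → ℝ → ℝ → ℝ) (t x : ℝ) :
    evolutionRHSDeriv W t x = transportCoeff W t x * W 2 t x + transportSource W t x := by
  simp only [evolutionRHSDeriv, transportSource, transportCoeff, fluxDeriv]
  ring

theorem pointSum_nonneg (W : ℕ → ℝ → ℝ → ℝ) (t x : ℝ) : 0 ≤ pointSum W t x := by
  unfold pointSum; positivity

theorem pointConv_nonneg (W : ℕ → ℝ → ℝ → ℝ) (t x : ℝ) : 0 ≤ pointConv W t x :=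
  integral_nonneg fun _ => mul_nonneg (Real.exp_pos _).le (pointSum_nonneg _ _ _)

theorem abs_le_pointSum (W : ℕ → ℝ → ℝ → ℝ) {k : ℕ} (hk : k ≤ 2) (t x : ℝ) :
    |W k t x| ≤ pointSum W t x := by
  have h0 := abs_nonneg (W 0 t x)
  have h1 := abs_nonneg (W 1 t x)
  have h2 := abs_nonneg (W 2 t x)
  unfold pointSum
  interval_cases k <;> linarith

namespace IsRegularFamily

variable {W : ℕ → ℝ → ℝ → ℝ} {M : ℝ}

theorem continuous_pointSum (h : IsRegularFamily W M) :
    Continuous (Function.uncurry (pointSum W)) :=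
  ((h.continuous 0 (by norm_num)).abs.add (h.continuous 1 (by norm_num)).abs).add
    (h.continuous 2 le_rfl).abs

theorem abs_pointSum_le (h : IsRegularFamily W M) (t x : ℝ) : |pointSum W t x| ≤ 3 * M := by
  rw [abs_of_nonneg (pointSum_nonneg W t x), pointSum]
  linarith [h.abs_le 0 (by norm_num) t x, h.abs_le 1 (by norm_num) t x, h.abs_le 2 le_rfl t x]

theorem continuous_pointConv (h : IsRegularFamily W M) :
    Continuous (Function.uncurry (pointConv W)) := by
  have hc := h.continuous_pointSum
  refine continuous_of_dominated
    (F := fun (q : ℝ × ℝ) y => Real.exp (-|y|) * pointSum W q.1 (q.2 - y))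
    (bound := fun y => Real.exp (-|y|) * (3 * M)) (fun q => ?_) (fun q => ?_)
    (integrable_exp_neg_abs.mul_const _) ?_
  · have h1 : Continuous fun y => pointSum W q.1 (q.2 - y) :=
      hc.comp (continuous_const.prodMk (continuous_const.sub continuous_id))
    exact ((Real.continuous_exp.comp continuous_abs.neg).mul h1).aestronglyMeasurable
  · refine Filter.Eventually.of_forall fun y => ?_
    rw [norm_mul, Real.norm_eq_abs, Real.norm_eq_abs, abs_of_pos (Real.exp_pos _)]
    gcongr
    exact h.abs_pointSum_le _ _
  · refine Filter.Eventually.of_forall fun y => ?_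
    exact continuous_const.mul
      (hc.comp (continuous_fst.prodMk (continuous_snd.sub continuous_const)))

theorem continuous_forcingMajorant (h : IsRegularFamily W M) :
    Continuous (Function.uncurry (forcingMajorant W M)) :=
  continuous_const.mul ((continuous_const.mul h.continuous_pointSum).add
    (continuous_const.mul h.continuous_pointConv))

theorem forcingMajorant_nonneg (h : IsRegularFamily W M) (t x : ℝ) :
    0 ≤ forcingMajorant W M t x := by
  have := h.bound_nonneg
  have := pointSum_nonneg W t x
  have := pointConv_nonneg W t x
  unfold forcingMajorant
  positivity

theorem abs_two_mul_sub_le_pointSum {k : ℕ} (hk : k < 2) (t x : ℝ) :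
    |2 * W k t x - W (k + 1) t x| ≤ 2 * pointSum W t x := by
  have h0 := abs_nonneg (W 0 t x)
  have h1 := abs_nonneg (W 1 t x)
  have h2 := abs_nonneg (W 2 t x)
  refine (abs_sub _ _).trans ?_
  rw [abs_mul, abs_two, pointSum]
  interval_cases k <;> simp only [zero_add, one_add_one_eq_two] <;> linarith

/-- One factor of the square is bounded by 3M, the other by twice the pointwise sum; this linearises
the quadratic term. -/
theorem abs_flux_le_pointSum (h : IsRegularFamily W M) (t x : ℝ) :
    |flux W t x| ≤ 6 * M * pointSum W t x := by
  have h0 := h.abs_two_mul_sub_le (k := 0) (by norm_num) t x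
  have h1 := abs_two_mul_sub_le_pointSum (W := W) (k := 0) (by norm_num) t x
  have := h.bound_nonneg
  rw [flux, pow_two, abs_mul]
  calc |2 * W 0 t x - W 1 t x| * |2 * W 0 t x - W 1 t x| ≤ (3 * M) * (2 * pointSum W t x) := by
        gcongr
    _ = 6 * M * pointSum W t x := by ring

theorem abs_fluxDeriv_le_pointSum (h : IsRegularFamily W M) (t x : ℝ) :
    |fluxDeriv W t x| ≤ 12 * M * pointSum W t x := by
  have h0 := h.abs_two_mul_sub_le (k := 0) (by norm_num) t x
  have h1 := abs_two_mul_sub_le_pointSum (W := W) (k := 1) (by norm_num) t x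
  have := h.bound_nonneg
  rw [fluxDeriv, abs_mul, abs_mul, abs_two]
  calc 2 * |2 * W 0 t x - W 1 t x| * |2 * W 1 t x - W 2 t x|
      ≤ 2 * (3 * M) * (2 * pointSum W t x) := by
        gcongr
    _ = 12 * M * pointSum W t x := by ring

theorem integral_exp_neg_abs_mul_pointSum (t x : ℝ) :
    ∫ y, Real.exp (-|y|) * (6 * M * pointSum W t (x - y)) = 6 * M * pointConv W t x := by
  rw [pointConv, ← integral_const_mul]
  congr 1 with y
  ring

theorem abs_leftExp_flux_le (h : IsRegularFamily W M) (t x : ℝ) :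
    |leftExp (flux W t) x| ≤ 6 * M * pointConv W t x := by
  have hc : Continuous (pointSum W t) := h.continuous_pointSum.comp (Continuous.prodMk_right t)
  rw [← integral_exp_neg_abs_mul_pointSum]
  refine abs_leftExp_le_integral (m := fun x => 6 * M * pointSum W t x) (B := 6 * M * (3 * M))
    (by fun_prop) (fun x => ?_) (h.abs_flux_le_pointSum t) x
  have := h.bound_nonneg
  rw [abs_mul, abs_of_nonneg (by positivity : 0 ≤ 6 * M)]
  gcongr
  exact h.abs_pointSum_le t x

theorem abs_rightExp_flux_le (h : IsRegularFamily W M) (t x : ℝ) :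
    |rightExp (flux W t) x| ≤ 6 * M * pointConv W t x := by
  have hc : Continuous (pointSum W t) := h.continuous_pointSum.comp (Continuous.prodMk_right t)
  rw [← integral_exp_neg_abs_mul_pointSum]
  refine abs_rightExp_le_integral (m := fun x => 6 * M * pointSum W t x) (B := 6 * M * (3 * M))
    (by fun_prop) (fun x => ?_) (h.abs_flux_le_pointSum t) x
  have := h.bound_nonneg
  rw [abs_mul, abs_of_nonneg (by positivity : 0 ≤ 6 * M)]
  gcongr
  exact h.abs_pointSum_le t x

theorem abs_evolutionRHS_le_forcingMajorant (h : IsRegularFamily W M) (t x : ℝ) :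
    |evolutionRHS W t x| ≤ forcingMajorant W M t x := by
  have h1 := _root_.abs_le.1 (h.abs_flux_le_pointSum t x)
  have h2 := _root_.abs_le.1 (h.abs_leftExp_flux_le t x)
  have h3 := _root_.abs_le.1 (h.abs_rightExp_flux_le t x)
  rw [evolutionRHS, forcingMajorant]
  exact _root_.abs_le.2 ⟨by linarith, by linarith⟩

theorem abs_evolutionRHSDeriv_le_forcingMajorant (h : IsRegularFamily W M) (t x : ℝ) :
    |evolutionRHSDeriv W t x| ≤ forcingMajorant W M t x := by
  have h0 := _root_.abs_le.1 (h.abs_fluxDeriv_le_pointSum t x)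
  have h1 := _root_.abs_le.1 (h.abs_flux_le_pointSum t x)
  have h2 := _root_.abs_le.1 (h.abs_leftExp_flux_le t x)
  have h3 := _root_.abs_le.1 (h.abs_rightExp_flux_le t x)
  rw [evolutionRHSDeriv, forcingMajorant]
  exact _root_.abs_le.2 ⟨by linarith, by linarith⟩

theorem abs_transportCoeff_le (h : IsRegularFamily W M) (t x : ℝ) :
    |transportCoeff W t x| ≤ 6 * M := by
  have h0 := h.abs_two_mul_sub_le (k := 0) (by norm_num) t x
  rw [transportCoeff, abs_mul, abs_two]
  linarith

/-- The source stops at u_x, so its derivative stops at u_xx. This is the extremal case for the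
constants: 24 from the product, 24 from 2F' and 6 from F add up to 54, and 6(3 + 1)/2 = 12 comes
from the convolutions. -/
theorem abs_transportSourceDeriv_le_forcingMajorant (h : IsRegularFamily W M) (t x : ℝ) :
    |transportSourceDeriv W t x| ≤ forcingMajorant W M t x := by
  have hM := h.bound_nonneg
  have h0 := _root_.abs_le.1 (h.abs_fluxDeriv_le_pointSum t x)
  have h1 := _root_.abs_le.1 (h.abs_flux_le_pointSum t x)
  have h2 := _root_.abs_le.1 (h.abs_leftExp_flux_le t x)
  have h3 := _root_.abs_le.1 (h.abs_rightExp_flux_le t x)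
  have h5 : |2 * (2 * W 1 t x - W 2 t x) * W 1 t x| ≤ 6 * M * pointSum W t x := by
    rw [abs_mul, abs_mul, abs_two]
    have a1 := h.abs_two_mul_sub_le (k := 1) (by norm_num) t x
    have a2 := abs_le_pointSum W (k := 1) (by norm_num) t x
    calc 2 * |2 * W 1 t x - W 2 t x| * |W 1 t x| ≤ 2 * (3 * M) * pointSum W t x := by
          gcongr
      _ = 6 * M * pointSum W t x := by ring
  have h6 : |transportCoeff W t x * W 2 t x| ≤ 6 * M * pointSum W t x := by
    rw [abs_mul]
    gcongr
    · exact h.abs_transportCoeff_le t x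
    · exact abs_le_pointSum W le_rfl t x
  have h5' := _root_.abs_le.1 h5
  have h6' := _root_.abs_le.1 h6
  rw [transportSourceDeriv, forcingMajorant]
  exact _root_.abs_le.2 ⟨by linarith, by linarith⟩

theorem hasDerivAt_evolutionRHS (h : IsRegularFamily W M) (t x : ℝ) :
    HasDerivAt (evolutionRHS W t) (evolutionRHSDeriv W t x) x := by
  have hc : Continuous (flux W t) := h.continuous_flux.comp (Continuous.prodMk_right t)
  have h1 := hasDerivAt_leftExp hc (h.abs_flux_le t) x
  have h2 := hasDerivAt_rightExp hc (h.abs_flux_le t) x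
  refine ((h.hasDerivAt_flux t x).neg.add (((h2.const_mul 3).sub h1).div_const 2)).congr_deriv ?_
  simp only [evolutionRHSDeriv]
  ring

theorem hasDerivAt_transportCoeff (h : IsRegularFamily W M) (t x : ℝ) :
    HasDerivAt (transportCoeff W t) (2 * (2 * W 1 t x - W 2 t x)) x :=
  (((h.hasDerivAt 0 (by norm_num) t x).const_mul 2).sub
    (h.hasDerivAt 1 (by norm_num) t x)).const_mul 2

theorem hasDerivAt_transportSource (h : IsRegularFamily W M) (t x : ℝ) :
    HasDerivAt (transportSource W t) (transportSourceDeriv W t x) x := by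
  have hc : Continuous (flux W t) := h.continuous_flux.comp (Continuous.prodMk_right t)
  have h1 := hasDerivAt_leftExp hc (h.abs_flux_le t) x
  have h2 := hasDerivAt_rightExp hc (h.abs_flux_le t) x
  have h3 := (h.hasDerivAt_transportCoeff t x).mul (h.hasDerivAt 1 (by norm_num) t x)
  refine (((h3.const_mul (-2)).sub ((h.hasDerivAt_flux t x).const_mul 2)).add
    (((h2.const_mul 3).add h1).div_const 2)).congr_deriv ?_
  simp only [transportSourceDeriv]
  ring

theorem continuous_evolutionRHSDeriv (h : IsRegularFamily W M) :
    Continuous (Function.uncurry (evolutionRHSDeriv W)) :=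
  (h.continuous_fluxDeriv.neg.sub (continuous_const.mul h.continuous_flux)).add
    (((continuous_const.mul h.continuous_rightExp_flux).add h.continuous_leftExp_flux).div_const 2)

theorem continuous_transportCoeff (h : IsRegularFamily W M) :
    Continuous (Function.uncurry (transportCoeff W)) :=
  continuous_const.mul ((continuous_const.mul (h.continuous 0 (by norm_num))).sub
    (h.continuous 1 (by norm_num)))

theorem continuous_transportSource (h : IsRegularFamily W M) :
    Continuous (Function.uncurry (transportSource W)) :=
  ((continuous_const.mul (h.continuous_transportCoeff.mul (h.continuous 1 (by norm_num)))).sub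
    (continuous_const.mul h.continuous_flux)).add
    (((continuous_const.mul h.continuous_rightExp_flux).add h.continuous_leftExp_flux).div_const 2)

/-- The time-integrated evolution equation may be differentiated in space. -/
theorem sub_eq_integral_evolutionRHSDeriv (h : IsRegularFamily W M) {t₁ t₂ : ℝ}
    (heq : ∀ x, W 0 t₂ x - W 0 t₁ x = ∫ τ in t₁..t₂, evolutionRHS W τ x) (x : ℝ) :
    W 1 t₂ x - W 1 t₁ x = ∫ τ in t₁..t₂, evolutionRHSDeriv W τ x := by
  have hE : ∀ x, Continuous fun τ => evolutionRHS W τ x := fun x =>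
    h.continuous_evolutionRHS.comp (Continuous.prodMk_left x)
  have hE' : ∀ x, Continuous fun τ => evolutionRHSDeriv W τ x := fun x =>
    h.continuous_evolutionRHSDeriv.comp (Continuous.prodMk_left x)
  have hbound : ∀ τ y, ‖evolutionRHSDeriv W τ y‖ ≤ 54 * M ^ 2 := by
    intro τ y
    have h0 := _root_.abs_le.1 (h.abs_fluxDeriv_le τ y)
    have h1 := _root_.abs_le.1 (h.abs_flux_le τ y)
    have h2 := _root_.abs_le.1 (abs_leftExp_le (h.abs_flux_le τ) y)
    have h3 := _root_.abs_le.1 (abs_rightExp_le (h.abs_flux_le τ) y)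
    rw [evolutionRHSDeriv, Real.norm_eq_abs]
    exact _root_.abs_le.2 ⟨by linarith, by linarith⟩
  have h1 := (intervalIntegral.hasDerivAt_integral_of_dominated_loc_of_deriv_le (μ := volume)
    (F := fun x τ => evolutionRHS W τ x) (F' := fun x τ => evolutionRHSDeriv W τ x) (x₀ := x)
    (a := t₁) (b := t₂) (bound := fun _ => 54 * M ^ 2) Filter.univ_mem
    (Filter.Eventually.of_forall fun y => (hE y).aestronglyMeasurable)
    ((hE x).intervalIntegrable _ _) (hE' x).aestronglyMeasurable
    (Filter.Eventually.of_forall fun τ _ y _ => hbound τ y) intervalIntegrable_const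
    (Filter.Eventually.of_forall fun τ _ y _ => h.hasDerivAt_evolutionRHS τ y)).2
  have h2 := (h.hasDerivAt 0 (by norm_num) t₂ x).sub (h.hasDerivAt 0 (by norm_num) t₁ x)
  have e : (W 0 t₂ - W 0 t₁) = fun x => ∫ τ in t₁..t₂, evolutionRHS W τ x := funext heq
  rw [e] at h2
  exact h2.unique h1

/-- The time derivatives of u and u_x involve nothing beyond u_xx, so integration at fixed x
suffices, without characteristics. -/
theorem abs_le_add_integral_forcingMajorant (h : IsRegularFamily W M) {t₁ t₂ : ℝ} (h12 : t₁ ≤ t₂)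
    (heq : ∀ x, W 0 t₂ x - W 0 t₁ x = ∫ τ in t₁..t₂, evolutionRHS W τ x) {k : ℕ} (hk : k < 2)
    (x : ℝ) : |W k t₂ x| ≤ |W k t₁ x| + ∫ τ in t₁..t₂, forcingMajorant W M τ x := by
  have hi : IntervalIntegrable (fun τ => forcingMajorant W M τ x) volume t₁ t₂ :=
    (h.continuous_forcingMajorant.comp (Continuous.prodMk_left x)).intervalIntegrable _ _
  have key : |W k t₂ x - W k t₁ x| ≤ ∫ τ in t₁..t₂, forcingMajorant W M τ x := by
    rw [← Real.norm_eq_abs]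
    interval_cases k
    · rw [heq]
      exact intervalIntegral.norm_integral_le_of_norm_le h12 (Filter.Eventually.of_forall
        fun τ _ => h.abs_evolutionRHS_le_forcingMajorant τ x) hi
    · rw [h.sub_eq_integral_evolutionRHSDeriv heq]
      exact intervalIntegral.norm_integral_le_of_norm_le h12 (Filter.Eventually.of_forall
        fun τ _ => h.abs_evolutionRHSDeriv_le_forcingMajorant τ x) hi
  have := abs_sub_abs_le_abs_sub (W k t₂ x) (W k t₁ x)
  linarith

/-- The estimate of `u_xx` along the characteristics that end at time `t₂`. -/
theorem exists_characteristics (h : IsRegularFamily W M) {t₁ t₂ : ℝ} (h12 : t₁ ≤ t₂)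
    (heq : ∀ t ∈ Icc t₁ t₂, ∀ x, W 0 t x - W 0 t₁ x = ∫ τ in t₁..t, evolutionRHS W τ x) :
    ∃ q : ℝ → ℝ → ℝ, Continuous (Function.uncurry q) ∧
      (∀ x τ, |q x τ - x| ≤ 6 * M * (t₂ - t₁)) ∧
      (∀ x y τ, |x - y| ≤ Real.exp (6 * M * (t₂ - t₁)) * |q x τ - q y τ|) ∧
      ∀ x, |W 2 t₂ x| ≤ Real.exp (6 * M * (t₂ - t₁)) *
        (|W 2 t₁ (q x t₁)| + ∫ τ in t₁..t₂, forcingMajorant W M τ (q x τ)) := by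
  have hM := h.bound_nonneg
  -- The same constant serves as speed and as Lipschitz constant: both |c| = 2|2u - u_x| and |c_x| =
  -- 2|2u_x - u_xx| are at most 6M.
  set L : NNReal := (6 * M).toNNReal with hL
  have hLM : (L : ℝ) = 6 * M := Real.coe_toNNReal _ (by positivity)
  have hc := h.continuous_transportCoeff
  obtain ⟨q, hqc, hq₂, hqd, hqx, hqΛ, hqΛ'⟩ := exists_terminal_flow_of_lipschitz
    (f := fun t x => -transportCoeff W t x) (L := L) (K := L)
    (fun t => by
      refine (lipschitzWith_of_nnnorm_deriv_le
        (fun x => (h.hasDerivAt_transportCoeff t x).differentiableAt) fun x => ?_).neg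
      rw [(h.hasDerivAt_transportCoeff t x).deriv, ← NNReal.coe_le_coe, coe_nnnorm, hLM,
        Real.norm_eq_abs, abs_mul, abs_two]
      linarith [h.abs_two_mul_sub_le (k := 1) (by norm_num) t x])
    (fun x => (hc.comp (Continuous.prodMk_left x)).neg)
    (fun t x => by rw [abs_neg, hLM]; exact h.abs_transportCoeff_le t x) h12
  rw [hLM] at hqx hqΛ hqΛ'
  refine ⟨q, hqc, hqx, hqΛ', ?_⟩
  refine abs_deriv_le_along_characteristic (r := W 1) (rt := evolutionRHSDeriv W)
    (c := transportCoeff W) (g := transportSource W) (g' := transportSourceDeriv W) h12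
    (Real.exp_pos _).le (h.continuous 1 (by norm_num)) (h.continuous 2 le_rfl)
    h.continuous_evolutionRHSDeriv h.continuous_transportSource h.continuous_forcingMajorant
    (h.hasDerivAt 1 (by norm_num)) ?_ (evolutionRHSDeriv_eq W) h.hasDerivAt_transportSource
    h.abs_transportSourceDeriv_le_forcingMajorant hqc hq₂ hqd hqΛ
  intro t ht x
  have hE' : Continuous fun τ => evolutionRHSDeriv W τ x :=
    h.continuous_evolutionRHSDeriv.comp (Continuous.prodMk_left x)
  have h1 := (intervalIntegral.integral_hasDerivAt_right (hE'.intervalIntegrable t₁ t)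
    (hE'.stronglyMeasurableAtFilter _ _) hE'.continuousAt).const_add (W 1 t₁ x)
  refine h1.congr_of_eventuallyEq ?_
  filter_upwards [Icc_mem_nhds ht.1 ht.2] with τ hτ
  rw [← h.sub_eq_integral_evolutionRHSDeriv (heq τ hτ)]
  ring

end IsRegularFamily

/-! ### Weighted L^p estimates -/

/-- Weighted Young inequality for the convolution with `e^{-|x|}` and a moderate weight. -/
theorem eLpNorm_conv_exp_neg_abs_mul_le {m φ v : ℝ → ℝ} {B D : ℝ} (hm : Continuous m)
    (hm0 : ∀ x, 0 ≤ m x) (hmB : ∀ x, |m x| ≤ B) (hφ : Continuous φ) (hφ0 : ∀ x, 0 < φ x)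
    (hv : ∀ x, 0 ≤ v x) (hvi : Integrable fun x => v x / Real.exp |x|) (hD : 0 ≤ D)
    (hmod : ∀ x y, φ (x + y) ≤ D * v x * φ y) {p : ℝ≥0∞} (hp : 1 ≤ p) :
    eLpNorm (fun x => (∫ y, Real.exp (-|y|) * m (x - y)) * φ x) p volume ≤
      ENNReal.ofReal (D * ∫ x, v x / Real.exp |x|) * eLpNorm (fun x => m x * φ x) p volume := by
  set k : ℝ → ℝ := fun y => D * (v y / Real.exp |y|) with hk
  have hki : Integrable k := hvi.const_mul D
  have hk0 : ∀ y, 0 ≤ k y := fun y => mul_nonneg hD (div_nonneg (hv y) (Real.exp_pos _).le)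
  -- Moderateness φ(x) ≤ D v(y) φ(x - y) bounds the weighted convolution by an average of translates
  -- of mφ against this finite measure. Minkowski and translation invariance then give the mass of ν
  -- as constant.
  set ν : Measure ℝ := volume.withDensity fun y => ENNReal.ofReal (k y) with hν
  have hkm : AEMeasurable (fun y => ENNReal.ofReal (k y)) :=
    hki.aestronglyMeasurable.aemeasurable.ennreal_ofReal
  have hνuniv : ν univ = ENNReal.ofReal (D * ∫ x, v x / Real.exp |x|) := by
    rw [hν, withDensity_apply _ MeasurableSet.univ, Measure.restrict_univ,
      ← ofReal_integral_eq_lintegral_ofReal hki (Filter.Eventually.of_forall hk0), hk,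
      integral_const_mul]
  have : IsFiniteMeasure ν := ⟨by rw [hνuniv]; exact ENNReal.ofReal_lt_top⟩
  have hmφ : Continuous fun x => m x * φ x := hm.mul hφ
  set f : ℝ → ℝ → ℝ≥0∞ := fun x y => ENNReal.ofReal (m (x - y) * φ (x - y)) with hf
  have hfm : Measurable (Function.uncurry f) := by
    have : Continuous fun q : ℝ × ℝ => m (q.1 - q.2) * φ (q.1 - q.2) :=
      hmφ.comp (continuous_fst.sub continuous_snd)
    exact this.measurable.ennreal_ofReal
  have hfB : ∀ y, eLpNorm (fun x => f x y) p volume ≤ eLpNorm (fun x => m x * φ x) p volume := by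
    intro y
    have h1 := eLpNorm_comp_measurePreserving (p := p) hmφ.aestronglyMeasurable
      (measurePreserving_sub_right volume y)
    rw [← h1]
    refine eLpNorm_mono_enorm fun x => ?_
    simp only [hf, Function.comp, enorm_eq_self]
    exact Real.ofReal_le_enorm _
  rw [← hνuniv]
  refine le_trans (eLpNorm_mono_enorm fun x => ?_)
    (eLpNorm_lintegral_le_measure_univ_mul volume ν hp hfm hfB)
  have hi : Integrable fun y => Real.exp (-|y|) * m (x - y) :=
    integrable_exp_neg_abs_mul (by fun_prop) (fun y => hmB (x - y))
  have hxf : AEMeasurable (f x) := (hfm.comp measurable_prodMk_left).aemeasurable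
  rw [enorm_eq_self, hν, lintegral_withDensity_eq_lintegral_mul₀ hkm hxf,
    Real.enorm_of_nonneg (mul_nonneg (integral_nonneg fun y =>
      mul_nonneg (Real.exp_pos _).le (hm0 _)) (hφ0 x).le), ← integral_mul_const,
    ofReal_integral_eq_lintegral_ofReal (hi.mul_const _) (Filter.Eventually.of_forall fun y =>
      mul_nonneg (mul_nonneg (Real.exp_pos _).le (hm0 _)) (hφ0 x).le)]
  refine lintegral_mono fun y => ?_
  simp only [Pi.mul_apply, hf]
  rw [← ENNReal.ofReal_mul (hk0 y)]
  refine ENNReal.ofReal_le_ofReal ?_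
  have h2 := hmod y (x - y)
  rw [add_sub_cancel] at h2
  calc Real.exp (-|y|) * m (x - y) * φ x
      ≤ Real.exp (-|y|) * m (x - y) * (D * v y * φ (x - y)) := by
        have := hm0 (x - y)
        gcongr
    _ = k y * (m (x - y) * φ (x - y)) := by
        rw [hk, Real.exp_neg]
        field_simp

/-- Minkowski's integral inequality on a time interval. -/
theorem eLpNorm_intervalIntegral_le {f : ℝ → ℝ → ℝ} (hf : Continuous (Function.uncurry f))
    (hf0 : ∀ x τ, 0 ≤ f x τ) {t₁ t₂ : ℝ} (h12 : t₁ ≤ t₂) {p : ℝ≥0∞} (hp : 1 ≤ p) {B : ℝ≥0∞}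
    (hB : ∀ τ ∈ Icc t₁ t₂, eLpNorm (fun x => f x τ) p volume ≤ B) :
    eLpNorm (fun x => ∫ τ in t₁..t₂, f x τ) p volume ≤ ENNReal.ofReal (t₂ - t₁) * B := by
  -- Freezing time outside the interval makes the slice bound valid for every τ, as Minkowski's
  -- inequality above demands.
  set g : ℝ → ℝ → ℝ := fun x τ => f x (projIcc t₁ t₂ h12 τ) with hg
  have hgc : Continuous (Function.uncurry g) := hf.comp (continuous_fst.prodMk
    (continuous_subtype_val.comp ((continuous_projIcc (h := h12)).comp continuous_snd)))
  have h1 := eLpNorm_lintegral_le_measure_univ_mul volume (volume.restrict (Ioc t₁ t₂)) hp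
    (f := fun x τ => ENNReal.ofReal (g x τ)) hgc.measurable.ennreal_ofReal (B := B) fun τ => by
      refine le_trans (eLpNorm_mono_enorm fun x => ?_) (hB _ (projIcc t₁ t₂ h12 τ).2)
      simp only [enorm_eq_self]
      exact Real.ofReal_le_enorm _
  rw [Measure.restrict_apply_univ, Real.volume_Ioc] at h1
  refine le_trans (eLpNorm_mono_enorm fun x => ?_) h1
  have hfx : Continuous (f x) := hf.comp (Continuous.prodMk_right x)
  rw [enorm_eq_self, Real.enorm_of_nonneg (intervalIntegral.integral_nonneg h12 fun τ _ => hf0 x τ),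
    intervalIntegral.integral_of_le h12, ofReal_integral_eq_lintegral_ofReal
      (hfx.integrableOn_Ioc) (Filter.Eventually.of_forall fun τ => hf0 x τ)]
  refine (setLIntegral_congr_fun measurableSet_Ioc fun τ hτ => ?_).le
  simp only [hg, projIcc_of_mem h12 (Ioc_subset_Icc_self hτ)]

/-- A weight with at most exponential variation that is moderate with respect to a weight `v` with
`v e^{-|·|}` integrable. -/
structure IsTameWeight (φ v : ℝ → ℝ) (A D : ℝ) : Prop where
  continuous : Continuous φ
  pos : ∀ x, 0 < φ x
  le_exp : ∀ x y, φ x ≤ Real.exp (A * |x - y|) * φ y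
  rate_nonneg : 0 ≤ A
  const_nonneg : 0 ≤ D
  moderate : ∀ x y, φ (x + y) ≤ D * v x * φ y
  nonneg : ∀ x, 0 ≤ v x
  integrable : Integrable fun x => v x / Real.exp |x|

theorem IsAdmissibleWeightWith.continuous {φ v : ℝ → ℝ} {A C₀ : ℝ}
    (h : IsAdmissibleWeightWith φ v A C₀) : Continuous φ :=
  continuous_iff_continuousAt.2 fun x =>
    (h.locally_absolutely_continuous (x - 1) (x + 1)).continuousOn.continuousAt
      (by rw [uIcc_of_le (by linarith)]; exact Icc_mem_nhds (by linarith) (by linarith))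

/-- The truncations of an admissible weight are tame, with constants that do not depend on the
height of the truncation. -/
theorem IsAdmissibleWeightWith.isTameWeight_min {φ v : ℝ → ℝ} {A C₀ : ℝ}
    (h : IsAdmissibleWeightWith φ v A C₀) {N : ℝ} (hN : 0 < N) :
    IsTameWeight (fun x => min (φ x) N) v A (max C₀ (⨅ x, v x)⁻¹) := by
  have hφ := h.continuous
  have hpos := h.moderate.pos
  have hC₀ := h.moderate.const_pos
  have hv := h.submultiplicative.nonneg
  refine ⟨hφ.min continuous_const, fun x => lt_min (hpos x) hN, fun x y => ?_, h.const_pos.le,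
    hC₀.le.trans (le_max_left _ _), fun x y => ?_, hv, h.integrable⟩
  · have h1 := le_exp_mul_of_abs_deriv_le h.const_pos h.locally_absolutely_continuous hpos
      h.deriv_le hφ x y
    have h2 : 1 ≤ Real.exp (A * |x - y|) :=
      Real.one_le_exp (mul_nonneg h.const_pos.le (abs_nonneg _))
    rw [mul_min_of_nonneg _ _ (Real.exp_pos _).le]
    exact min_le_min h1 (le_mul_of_one_le_left hN.le h2)
  · have hD : 0 ≤ max C₀ (⨅ x, v x)⁻¹ := hC₀.le.trans (le_max_left _ _)
    rw [mul_min_of_nonneg _ _ (mul_nonneg hD (hv x))]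
    refine min_le_min ((h.moderate.le x y).trans ?_) (le_mul_of_one_le_left hN.le ?_)
    · have := hv x
      have := (hpos y).le
      gcongr
      exact le_max_left _ _
    -- Where the truncation N is active one needs 1 ≤ D v(x); this holds because D is at least the
    -- reciprocal of the positive infimum of v.
    · have h3 : (⨅ x, v x) ≤ v x := ciInf_le ⟨0, by rintro _ ⟨z, rfl⟩; exact hv z⟩ x
      calc (1 : ℝ) = (⨅ x, v x)⁻¹ * ⨅ x, v x := (inv_mul_cancel₀ h.inf_pos.ne').symm
        _ ≤ max C₀ (⨅ x, v x)⁻¹ * v x := by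
          have := h.inf_pos.le
          gcongr
          exact le_max_right _ _

/-- `‖u φ‖_p + ‖u_x φ‖_p + ‖u_xx φ‖_p` for a regular family. -/
noncomputable def familyNorm (W : ℕ → ℝ → ℝ → ℝ) (φ : ℝ → ℝ) (p : ℝ≥0∞) (t : ℝ) : ℝ≥0∞ :=
  eLpNorm (fun x => W 0 t x * φ x) p volume + eLpNorm (fun x => W 1 t x * φ x) p volume
    + eLpNorm (fun x => W 2 t x * φ x) p volume

namespace IsRegularFamily

variable {W : ℕ → ℝ → ℝ → ℝ} {M : ℝ} {φ v : ℝ → ℝ} {A D : ℝ} {p : ℝ≥0∞}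

theorem eLpNorm_pointSum_mul_le (h : IsRegularFamily W M) (hφ : IsTameWeight φ v A D)
    (hp : 1 ≤ p) (t : ℝ) :
    eLpNorm (fun x => pointSum W t x * φ x) p volume ≤ familyNorm W φ p t := by
  have hm : ∀ k ≤ 2, AEStronglyMeasurable (fun x => |W k t x * φ x|) volume := fun k hk =>
    ((h.continuous_slice hk t).mul hφ.continuous).abs.aestronglyMeasurable
  have e : (fun x => pointSum W t x * φ x) =
      ((fun x => |W 0 t x * φ x|) + fun x => |W 1 t x * φ x|) + fun x => |W 2 t x * φ x| := by
    ext x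
    simp only [pointSum, Pi.add_apply, abs_mul, abs_of_pos (hφ.pos x)]
    ring
  have habs : ∀ k, eLpNorm (fun x => |W k t x * φ x|) p volume =
      eLpNorm (fun x => W k t x * φ x) p volume := fun k => eLpNorm_norm (fun x => W k t x * φ x)
  rw [e, familyNorm, ← habs, ← habs, ← habs]
  refine (eLpNorm_add_le ((hm 0 (by norm_num)).add (hm 1 (by norm_num))) (hm 2 le_rfl) hp).trans ?_
  gcongr
  exact eLpNorm_add_le (hm 0 (by norm_num)) (hm 1 (by norm_num)) hp

/-- Minkowski for the local part and weighted Young for the convolution: the forcing is linear in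
the weighted norm, with a factor proportional to M. -/
theorem eLpNorm_forcingMajorant_mul_le (h : IsRegularFamily W M) (hφ : IsTameWeight φ v A D)
    (hp : 1 ≤ p) (t : ℝ) :
    eLpNorm (fun x => forcingMajorant W M t x * φ x) p volume ≤
      ENNReal.ofReal (M * (54 + 12 * (D * ∫ x, v x / Real.exp |x|))) * familyNorm W φ p t := by
  have hM := h.bound_nonneg
  have hc : Continuous (pointSum W t) := h.continuous_pointSum.comp (Continuous.prodMk_right t)
  have hc' : Continuous (pointConv W t) := h.continuous_pointConv.comp (Continuous.prodMk_right t)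
  have h1 := h.eLpNorm_pointSum_mul_le hφ hp t
  have h2 := eLpNorm_conv_exp_neg_abs_mul_le hc (pointSum_nonneg W t) (h.abs_pointSum_le t)
    hφ.continuous hφ.pos hφ.nonneg hφ.integrable hφ.const_nonneg hφ.moderate hp
  have hI : 0 ≤ D * ∫ x, v x / Real.exp |x| := mul_nonneg hφ.const_nonneg
    (integral_nonneg fun x => div_nonneg (hφ.nonneg x) (Real.exp_pos _).le)
  have e : (fun x => forcingMajorant W M t x * φ x) =
      (fun x => (54 * M) • (pointSum W t x * φ x)) +
        fun x => (12 * M) • (pointConv W t x * φ x) := by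
    ext x
    simp only [forcingMajorant, Pi.add_apply, smul_eq_mul]
    ring
  have hφc := hφ.continuous
  rw [e]
  refine (eLpNorm_add_le (by fun_prop) (by fun_prop) hp).trans ?_
  have s1 := eLpNorm_const_smul (54 * M) (fun x => pointSum W t x * φ x) p volume
  have s2 := eLpNorm_const_smul (12 * M) (fun x => pointConv W t x * φ x) p volume
  rw [Real.enorm_of_nonneg (by positivity)] at s1 s2
  calc _ ≤ ENNReal.ofReal (54 * M) * eLpNorm (fun x => pointSum W t x * φ x) p volume +
        ENNReal.ofReal (12 * M) * eLpNorm (fun x => pointConv W t x * φ x) p volume :=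
        add_le_add s1.le s2.le
    _ ≤ ENNReal.ofReal (54 * M) * familyNorm W φ p t + ENNReal.ofReal (12 * M) *
        (ENNReal.ofReal (D * ∫ x, v x / Real.exp |x|) * familyNorm W φ p t) := by
        gcongr
        exact h2.trans (by gcongr)
    _ = _ := by
        rw [← mul_assoc, ← add_mul, ← ENNReal.ofReal_mul (by positivity),
          ← ENNReal.ofReal_add (by positivity) (by positivity)]
        congr 2
        ring

/-- Propagation of the weighted norms over a time interval. -/
theorem familyNorm_le (h : IsRegularFamily W M) (hφ : IsTameWeight φ v A D) (hp : 1 ≤ p)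
    {t₁ t₂ : ℝ} (h12 : t₁ ≤ t₂)
    (heq : ∀ t ∈ Icc t₁ t₂, ∀ x, W 0 t x - W 0 t₁ x = ∫ τ in t₁..t, evolutionRHS W τ x)
    {S : ℝ≥0∞} (hS : ∀ τ ∈ Icc t₁ t₂, familyNorm W φ p τ ≤ S) :
    familyNorm W φ p t₂ ≤ ENNReal.ofReal (Real.exp ((12 + 6 * A) * M * (t₂ - t₁))) *
      (familyNorm W φ p t₁ + 3 * (ENNReal.ofReal (t₂ - t₁) *
        (ENNReal.ofReal (M * (54 + 12 * (D * ∫ x, v x / Real.exp |x|))) * S))) := by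
  have hM := h.bound_nonneg
  have hA := hφ.rate_nonneg
  have hφc := hφ.continuous
  set Γ : ℝ≥0∞ := ENNReal.ofReal (M * (54 + 12 * (D * ∫ x, v x / Real.exp |x|))) with hΓ
  have hHB : ∀ τ ∈ Icc t₁ t₂,
      eLpNorm (fun x => forcingMajorant W M τ x * φ x) p volume ≤ Γ * S := fun τ hτ =>
    (h.eLpNorm_forcingMajorant_mul_le hφ hp τ).trans (by gcongr; exact hS τ hτ)
  have hHc := h.continuous_forcingMajorant
  have hone : 1 ≤ ENNReal.ofReal (Real.exp ((12 + 6 * A) * M * (t₂ - t₁))) := by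
    rw [← ENNReal.ofReal_one]
    exact ENNReal.ofReal_le_ofReal (Real.one_le_exp (by positivity))
  -- The exponential factor is not needed for u and u_x; it is inserted to match the bound for u_xx.
  have low : ∀ k < 2, eLpNorm (fun x => W k t₂ x * φ x) p volume ≤
      ENNReal.ofReal (Real.exp ((12 + 6 * A) * M * (t₂ - t₁))) *
        (eLpNorm (fun x => W k t₁ x * φ x) p volume + ENNReal.ofReal (t₂ - t₁) * (Γ * S)) := by
    intro k hk
    refine le_trans ?_ (le_mul_of_one_le_left zero_le hone)
    have hFc : Continuous (Function.uncurry fun x τ => forcingMajorant W M τ x * φ x) :=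
      (hHc.comp continuous_swap).mul (hφc.comp continuous_fst)
    have hJ := eLpNorm_intervalIntegral_le hFc
      (fun x τ => mul_nonneg (h.forcingMajorant_nonneg τ x) (hφ.pos x).le) h12 hp hHB
    have hJc : Continuous fun x => ∫ τ in t₁..t₂, forcingMajorant W M τ x * φ x :=
      intervalIntegral.continuous_parametric_intervalIntegral_of_continuous'
        (f := fun x τ => forcingMajorant W M τ x * φ x) hFc t₁ t₂
    have hWc := h.continuous_slice hk.le t₁
    have hsum := eLpNorm_add_le (μ := volume) (f := fun x => |W k t₁ x * φ x|)
      (g := fun x => ∫ τ in t₁..t₂, forcingMajorant W M τ x * φ x)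
      (by fun_prop) hJc.aestronglyMeasurable hp
    have habs : eLpNorm (fun x => |W k t₁ x * φ x|) p volume =
      eLpNorm (fun x => W k t₁ x * φ x) p volume := eLpNorm_norm (fun x => W k t₁ x * φ x)
    rw [habs] at hsum
    refine le_trans (eLpNorm_mono_real fun x => ?_) (hsum.trans (by gcongr))
    rw [Real.norm_eq_abs, abs_mul, abs_of_pos (hφ.pos x), Pi.add_apply, abs_mul,
      abs_of_pos (hφ.pos x), intervalIntegral.integral_mul_const, ← add_mul]
    gcongr
    · exact (hφ.pos x).le
    · exact h.abs_le_add_integral_forcingMajorant h12 (heq t₂ ⟨h12, le_rfl⟩) hk x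
  have high : eLpNorm (fun x => W 2 t₂ x * φ x) p volume ≤
      ENNReal.ofReal (Real.exp ((12 + 6 * A) * M * (t₂ - t₁))) *
        (eLpNorm (fun x => W 2 t₁ x * φ x) p volume + ENNReal.ofReal (t₂ - t₁) * (Γ * S)) := by
    obtain ⟨q, hqc, hqx, hqa, hq⟩ := h.exists_characteristics h12 heq
    set Λ : ℝ := Real.exp (6 * M * (t₂ - t₁)) with hΛ
    have hΛ0 : 0 < Λ := Real.exp_pos _
    have hΛ1 : 1 ≤ Λ := Real.one_le_exp (by positivity)
    have hqτ : ∀ τ, Continuous fun x => q x τ := fun τ => hqc.comp (Continuous.prodMk_left τ)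
    have hanti : ∀ τ, AntilipschitzWith Λ.toNNReal fun x => q x τ := fun τ =>
      AntilipschitzWith.of_le_mul_dist fun x y => by
        rw [Real.coe_toNNReal _ hΛ0.le]
        exact hqa x y τ
    have hcomp : ∀ {f : ℝ → ℝ}, Continuous f → ∀ τ,
        eLpNorm (fun x => f (q x τ)) p volume ≤ ENNReal.ofReal Λ * eLpNorm f p volume :=
      fun hf τ => eLpNorm_comp_le_of_antilipschitzWith (by simpa using hΛ1) (hanti τ) (hqτ τ) hp hf
    have hWc := h.continuous_slice (k := 2) le_rfl t₁
    have hFc : Continuous (Function.uncurry fun x τ =>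
        forcingMajorant W M τ (q x τ) * φ (q x τ)) :=
      (hHc.comp (continuous_snd.prodMk hqc)).mul (hφc.comp hqc)
    have hJ := eLpNorm_intervalIntegral_le (B := ENNReal.ofReal Λ * (Γ * S)) hFc
      (fun x τ => mul_nonneg (h.forcingMajorant_nonneg τ _) (hφ.pos _).le) h12 hp
      fun τ hτ => (hcomp (f := fun x => forcingMajorant W M τ x * φ x)
        ((hHc.comp (Continuous.prodMk_right τ)).mul hφc) τ).trans (by gcongr; exact hHB τ hτ)
    have hJc : Continuous fun x => ∫ τ in t₁..t₂, forcingMajorant W M τ (q x τ) * φ (q x τ) :=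
      intervalIntegral.continuous_parametric_intervalIntegral_of_continuous'
        (f := fun x τ => forcingMajorant W M τ (q x τ) * φ (q x τ)) hFc t₁ t₂
    have hW1 : eLpNorm (fun x => |W 2 t₁ (q x t₁) * φ (q x t₁)|) p volume ≤
        ENNReal.ofReal Λ * eLpNorm (fun x => W 2 t₁ x * φ x) p volume := by
      refine le_trans (le_of_eq ?_) (hcomp (f := fun x => W 2 t₁ x * φ x) (hWc.mul hφc) t₁)
      exact eLpNorm_norm (fun x => W 2 t₁ (q x t₁) * φ (q x t₁))
    have hsum := eLpNorm_add_le (μ := volume) (f := fun x => |W 2 t₁ (q x t₁) * φ (q x t₁)|)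
      (g := fun x => ∫ τ in t₁..t₂, forcingMajorant W M τ (q x τ) * φ (q x τ))
      (by fun_prop) hJc.aestronglyMeasurable hp
    -- A characteristic moves by at most 6M(t₂ - t₁), so the weight changes by at most Θ. With one Λ
    -- from the derivative estimate and one from the change of variables, the rate is 6 + 6 + 6A =
    -- 12 + 6A.
    set Θ : ℝ := Real.exp (A * (6 * M * (t₂ - t₁))) with hΘ
    have hφq : ∀ x τ, φ x ≤ Θ * φ (q x τ) := fun x τ => by
      refine (hφ.le_exp x (q x τ)).trans ?_
      have := (hφ.pos (q x τ)).le
      rw [abs_sub_comm]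
      exact mul_le_mul_of_nonneg_right
        (Real.exp_le_exp.2 (mul_le_mul_of_nonneg_left (hqx x τ) hA)) this
    have hpt : ∀ x, ‖W 2 t₂ x * φ x‖ ≤ Λ * Θ * ‖((fun x => |W 2 t₁ (q x t₁) * φ (q x t₁)|) +
        fun x => ∫ τ in t₁..t₂, forcingMajorant W M τ (q x τ) * φ (q x τ)) x‖ := by
      intro x
      have hI0 : 0 ≤ ∫ τ in t₁..t₂, forcingMajorant W M τ (q x τ) * φ (q x τ) :=
        intervalIntegral.integral_nonneg h12 fun τ _ =>
          mul_nonneg (h.forcingMajorant_nonneg τ _) (hφ.pos _).le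
      have hcx : Continuous fun τ => forcingMajorant W M τ (q x τ) :=
        hHc.comp (continuous_id.prodMk (hqc.comp (Continuous.prodMk_right x)))
      have hcφ : Continuous fun τ => φ (q x τ) := hφc.comp (hqc.comp (Continuous.prodMk_right x))
      have hI1 : (∫ τ in t₁..t₂, forcingMajorant W M τ (q x τ)) * φ x ≤
          Θ * ∫ τ in t₁..t₂, forcingMajorant W M τ (q x τ) * φ (q x τ) := by
        rw [← intervalIntegral.integral_mul_const, ← intervalIntegral.integral_const_mul]
        refine intervalIntegral.integral_mono h12 ((hcx.mul_const _).intervalIntegrable _ _)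
          (((hcx.mul hcφ).const_mul _).intervalIntegrable _ _) fun τ => ?_
        have h0 := h.forcingMajorant_nonneg τ (q x τ)
        calc forcingMajorant W M τ (q x τ) * φ x
            ≤ forcingMajorant W M τ (q x τ) * (Θ * φ (q x τ)) := by gcongr; exact hφq x τ
          _ = _ := by ring
      rw [Pi.add_apply, Real.norm_eq_abs, Real.norm_eq_abs, abs_of_nonneg (add_nonneg
        (abs_nonneg _) hI0), abs_mul, abs_mul, abs_of_pos (hφ.pos x), abs_of_pos (hφ.pos _)]
      calc |W 2 t₂ x| * φ x
          ≤ Λ * (|W 2 t₁ (q x t₁)| + ∫ τ in t₁..t₂, forcingMajorant W M τ (q x τ)) * φ x := by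
            have := (hφ.pos x).le
            gcongr
            exact hq x
        _ = Λ * (|W 2 t₁ (q x t₁)| * φ x +
            (∫ τ in t₁..t₂, forcingMajorant W M τ (q x τ)) * φ x) := by ring
        _ ≤ Λ * (|W 2 t₁ (q x t₁)| * (Θ * φ (q x t₁)) +
            Θ * ∫ τ in t₁..t₂, forcingMajorant W M τ (q x τ) * φ (q x τ)) := by
            gcongr
            exact hφq x t₁
        _ = _ := by ring
    refine (eLpNorm_le_mul_eLpNorm_of_ae_le_mul (Filter.Eventually.of_forall hpt) p).trans ?_
    calc _ ≤ ENNReal.ofReal (Λ * Θ) *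
          (ENNReal.ofReal Λ * eLpNorm (fun x => W 2 t₁ x * φ x) p volume +
            ENNReal.ofReal (t₂ - t₁) * (ENNReal.ofReal Λ * (Γ * S))) := by
          gcongr
          exact hsum.trans (by gcongr)
      _ = ENNReal.ofReal (Λ * Θ) * ENNReal.ofReal Λ *
          (eLpNorm (fun x => W 2 t₁ x * φ x) p volume + ENNReal.ofReal (t₂ - t₁) * (Γ * S)) := by
          ring
      _ = _ := by
          rw [← ENNReal.ofReal_mul (by positivity), hΛ, hΘ, ← Real.exp_add, ← Real.exp_add]
          congr 3
          ring
  calc familyNorm W φ p t₂ ≤ _ :=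
        add_le_add (add_le_add (low 0 (by norm_num)) (low 1 (by norm_num))) high
    _ = _ := by
        rw [familyNorm]
        ring

end IsRegularFamily

/-! ### Gronwall for truncated weights and conclusion -/

/-- An essential bound for a continuous function holds everywhere. -/
theorem abs_le_of_eLpNorm_top_le {f : ℝ → ℝ} (hf : Continuous f) {M : ℝ} (hM : 0 ≤ M)
    (h : eLpNorm f ∞ volume ≤ ENNReal.ofReal M) (x : ℝ) : |f x| ≤ M := by
  rw [eLpNorm_exponent_top] at h
  have hae : ∀ᵐ y, |f y| ≤ M := by
    filter_upwards [ae_le_eLpNormEssSup (f := f) (μ := volume)] with y hy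
    have := hy.trans h
    rwa [Real.enorm_eq_ofReal_abs, ENNReal.ofReal_le_ofReal_iff hM] at this
  have hd : Dense {y | |f y| ≤ M} := Measure.dense_of_ae hae
  have hc : IsClosed {y | |f y| ≤ M} := isClosed_le hf.abs continuous_const
  exact hc.closure_subset (hd x)

theorem deriv_eq_of_family {W : ℕ → ℝ → ℝ → ℝ}
    (hW : ∀ k < 2, ∀ t x, HasDerivAt (W k t) (W (k + 1) t x) x) (t : ℝ) :
    deriv (W 0 t) = W 1 t ∧ iteratedDeriv 2 (W 0 t) = W 2 t := by
  have h1 : deriv (W 0 t) = W 1 t := funext fun x => (hW 0 two_pos t x).deriv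
  refine ⟨h1, ?_⟩
  rw [iteratedDeriv_succ, iteratedDeriv_one, h1]
  exact funext fun x => (hW 1 one_lt_two t x).deriv

theorem weightedNorm_eq_familyNorm {W : ℕ → ℝ → ℝ → ℝ}
    (hW : ∀ k < 2, ∀ t x, HasDerivAt (W k t) (W (k + 1) t x) x) (φ : ℝ → ℝ) (p : ℝ≥0∞) (t : ℝ) :
    weightedNorm φ p (W 0 t) = familyNorm W φ p t := by
  rw [weightedNorm, (deriv_eq_of_family hW t).1, (deriv_eq_of_family hW t).2, familyNorm]

/-- The weighted norm of an `L²`-bounded regular family is bounded in time when the weight is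
bounded. -/
theorem exists_familyNorm_le_of_weight_le {W : ℕ → ℝ → ℝ → ℝ} {B : ℝ} {R p : ℝ≥0∞} (hp : 2 ≤ p)
    (hR : R ≠ ∞) (hB : ∀ k ≤ 2, ∀ t x, |W k t x| ≤ B)
    (hW : ∀ k ≤ 2, ∀ t, eLpNorm (W k t) 2 volume ≤ R) {φ : ℝ → ℝ} {N : ℝ}
    (hφ : ∀ x, |φ x| ≤ N) : ∃ R' ≠ ∞, ∀ t, familyNorm W φ p t ≤ R' := by
  obtain ⟨R₁, hR₁, h⟩ := exists_eLpNorm_le_of_two_le hp B hR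
  have key : ∀ k ≤ 2, ∀ t, eLpNorm (fun x => W k t x * φ x) p volume ≤
      ENNReal.ofReal N * R₁ := fun k hk t => by
    refine (eLpNorm_le_mul_eLpNorm_of_ae_le_mul (g := W k t) (c := N)
      (Filter.Eventually.of_forall fun x => ?_) p).trans ?_
    · rw [Real.norm_eq_abs, Real.norm_eq_abs, abs_mul, mul_comm]
      gcongr
      exact hφ x
    · gcongr
      exact h _ (hB k hk t) (hW k hk t)
  refine ⟨ENNReal.ofReal N * R₁ + ENNReal.ofReal N * R₁ + ENNReal.ofReal N * R₁, ?_, fun t => ?_⟩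
  · finiteness
  · exact add_le_add (add_le_add (key 0 (by norm_num) t) (key 1 (by norm_num) t))
      (key 2 le_rfl t)

/-- Persistence of the weighted norm for a regular family, for a bounded tame weight. -/
theorem IsRegularFamily.familyNorm_le_exp_mul {W : ℕ → ℝ → ℝ → ℝ} {M A D T : ℝ}
    {φ v : ℝ → ℝ} {p R : ℝ≥0∞} (h : IsRegularFamily W M) (hφ : IsTameWeight φ v A D) (hp : 1 ≤ p)
    (hR : R ≠ ∞) (hWR : ∀ t, familyNorm W φ p t ≤ R)
    (heq : ∀ t₁ t₂, 0 ≤ t₁ → t₁ ≤ t₂ → t₂ ≤ T → ∀ x,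
      W 0 t₂ x - W 0 t₁ x = ∫ τ in t₁..t₂, evolutionRHS W τ x) {t : ℝ} (ht : t ∈ Icc 0 T) :
    familyNorm W φ p t ≤
      ENNReal.ofReal (Real.exp ((12 + 6 * A + 12 * (54 + 12 * (D * ∫ x, v x / Real.exp |x|)))
        * M * t)) * familyNorm W φ p 0 := by
  have hM := h.bound_nonneg
  have hA := hφ.rate_nonneg
  have hD := hφ.const_nonneg
  have hI : 0 ≤ ∫ x, v x / Real.exp |x| :=
    integral_nonneg fun x => div_nonneg (hφ.nonneg x) (Real.exp_pos _).le
  set I : ℝ := ∫ x, v x / Real.exp |x|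
  have hfin : ∀ τ, familyNorm W φ p τ ≠ ∞ := fun τ => ne_top_of_le_ne_top hR (hWR τ)
  -- The 3 in b counts the three norms. The rate a + 4b is a multiple of M not involving R.
  have main := le_exp_mul_of_local_sup_bound (T := T) (a := (12 + 6 * A) * M)
    (b := 3 * (M * (54 + 12 * (D * I)))) (R := R.toReal)
    (n := fun τ => (familyNorm W φ p τ).toReal) (by positivity) (by positivity)
    (fun τ _ => ENNReal.toReal_nonneg) (fun τ _ => ENNReal.toReal_mono hR (hWR τ))
    fun t₁ t₂ S h0 h12 h2 hS => by
      have hS0 : 0 ≤ S := ENNReal.toReal_nonneg.trans (hS t₁ ⟨le_rfl, h12⟩)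
      have hδ : 0 ≤ t₂ - t₁ := sub_nonneg.2 h12
      have hle := h.familyNorm_le hφ hp h12
        (fun t ht => heq t₁ t h0 ht.1 (ht.2.trans h2)) (S := ENNReal.ofReal S)
        fun τ hτ => (ENNReal.le_ofReal_iff_toReal_le (hfin τ) hS0).2 (hS τ hτ)
      have hne : familyNorm W φ p t₁ ≠ ∞ := hfin t₁
      refine (ENNReal.toReal_mono (by finiteness) hle).trans (le_of_eq ?_)
      rw [ENNReal.toReal_mul, ENNReal.toReal_add hne (by finiteness), ENNReal.toReal_mul,
        ENNReal.toReal_mul, ENNReal.toReal_mul, ENNReal.toReal_ofReal (by positivity),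
        ENNReal.toReal_ofReal hδ, ENNReal.toReal_ofReal (by positivity),
        ENNReal.toReal_ofReal hS0, ENNReal.toReal_ofNat]
      ring
  have := main t ht
  rw [← ENNReal.toReal_ofReal (Real.exp_pos _).le, ← ENNReal.toReal_mul,
    ENNReal.toReal_le_toReal (hfin t) (ENNReal.mul_ne_top ENNReal.ofReal_ne_top (hfin 0))] at this
  refine this.trans (le_of_eq ?_)
  congr 3
  ring

theorem theorem3p1 (A C₀ α I : ℝ) :
    ∃ C : ℝ, 0 < C ∧
      ∀ (T s : ℝ) (p : ℝ≥0∞) (φ v u₀ : ℝ → ℝ) (u : ℝ → ℝ → ℝ),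
        0 < T → 5 / 2 < s → 2 ≤ p →
        IsAdmissibleWeightWith φ v A C₀ →
        (⨅ x, v x) = α →
        (∫ x, v x / Real.exp |x|) = I →
        IsStrongSolution T s u₀ u →
        MemLp (fun x => u₀ x * φ x) p volume →
        MemLp (fun x => deriv u₀ x * φ x) p volume →
        MemLp (fun x => iteratedDeriv 2 u₀ x * φ x) p volume →
        supNorm T u < ∞ ∧
        ∀ t ∈ Icc 0 T,
          weightedNorm φ p (u t)
            ≤ weightedNorm φ p u₀ * ENNReal.ofReal (Real.exp (C * (supNorm T u).toReal * t)) := by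
  -- The maximum with 1 gives positivity for arbitrary real parameters, and max C₀ α⁻¹ is the
  -- moderateness constant common to all truncations.
  refine ⟨max 1 (12 + 6 * A + 12 * (54 + 12 * (max C₀ α⁻¹ * I))), lt_max_of_lt_left one_pos, ?_⟩
  rintro T s p φ v u₀ u hT hs hp hφ rfl rfl hu - - -
  obtain ⟨W, B, R, hR, hW0, hWd, hWc, hWB, hWR⟩ :=
    hu.continuous_sobolev.exists_derivatives hT.le hs hu.continuous_rep
  have hWu : ∀ t ∈ Icc 0 T, W 0 t = u t := fun t ht => funext fun x => by
    rw [hW0, projIcc_of_mem hT.le ht]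
  have hproj : ∀ t, W 0 t = u (projIcc 0 T hT.le t : ℝ) := fun t => funext (hW0 t)
  have hWc' : ∀ k ≤ 2, ∀ t, Continuous (W k t) := fun k hk t =>
    (hWc k hk).comp (Continuous.prodMk_right t)
  have htop : ∀ k ≤ 2, ∀ t, eLpNorm (W k t) ∞ volume ≤ ENNReal.ofReal B := fun k hk t => by
    rw [eLpNorm_exponent_top]
    refine eLpNormEssSup_le_of_ae_bound (Filter.Eventually.of_forall fun x => ?_)
    exact hWB k hk t x
  have hsup : supNorm T u < ∞ := by
    refine lt_of_le_of_lt (b := ENNReal.ofReal B + ENNReal.ofReal B + ENNReal.ofReal B)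
      (iSup₂_le fun t ht => ?_) (by finiteness)
    rw [← hWu t ht, (deriv_eq_of_family hWd t).1, (deriv_eq_of_family hWd t).2]
    exact add_le_add (add_le_add (htop 0 (by norm_num) t) (htop 1 (by norm_num) t))
      (htop 2 le_rfl t)
  refine ⟨hsup, fun t ht => ?_⟩
  have hsum : ∀ t, eLpNorm (W 0 t) ∞ volume + eLpNorm (W 1 t) ∞ volume
      + eLpNorm (W 2 t) ∞ volume ≤ supNorm T u := fun t => by
    rw [← (deriv_eq_of_family hWd t).1, ← (deriv_eq_of_family hWd t).2, hproj]
    exact le_iSup₂ (f := fun t (_ : t ∈ Icc 0 T) => eLpNorm (u t) ∞ volume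
      + eLpNorm (deriv (u t)) ∞ volume + eLpNorm (iteratedDeriv 2 (u t)) ∞ volume)
      _ (projIcc 0 T hT.le t).2
  set M : ℝ := (supNorm T u).toReal
  have hM : ENNReal.ofReal M = supNorm T u := ENNReal.ofReal_toReal hsup.ne
  have hM0 : 0 ≤ M := ENNReal.toReal_nonneg
  -- The Sobolev bound B only showed that M is finite. The family is now regular with bound M
  -- itself, so that the rate depends on the solution through M alone; freezing in time makes this
  -- valid for every t.
  have hreg : IsRegularFamily W M := by
    refine ⟨hWd, hWc, fun k hk t => abs_le_of_eLpNorm_top_le (hWc' k hk t) hM0 ?_⟩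
    rw [hM]
    refine le_trans ?_ (hsum t)
    interval_cases k
    · exact le_self_add.trans le_self_add
    · exact le_add_self.trans le_self_add
    · exact le_add_self
  have h0T : (0 : ℝ) ∈ Icc 0 T := ⟨le_rfl, hT.le⟩
  rw [← hu.initial, ← hWu t ht, ← hWu 0 h0T, weightedNorm_eq_familyNorm hWd,
    weightedNorm_eq_familyNorm hWd, mul_comm]
  have hlim : Filter.Tendsto (fun N : ℕ => familyNorm W (fun x => min (φ x) N) p t) Filter.atTop
      (nhds (familyNorm W φ p t)) := by
    have hφc : Continuous φ := hφ.continuous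
    have := fun k (hk : k ≤ 2) =>
      tendsto_eLpNorm_mul_min p (hWc' k hk t) hφc hφ.moderate.pos
    exact ((this 0 (by norm_num)).add (this 1 (by norm_num))).add (this 2 le_rfl)
  -- The limit N → ∞ is taken only on the left; on the right the truncated initial norm is at most
  -- the full one.
  refine le_of_tendsto hlim ?_
  filter_upwards [Filter.eventually_ge_atTop 1] with N hN
  have hN0 : (0 : ℝ) < N := by exact_mod_cast hN
  have hmin0 : ∀ x, 0 < min (φ x) N := fun x => lt_min (hφ.moderate.pos x) hN0
  obtain ⟨R', hR', hWR'⟩ := exists_familyNorm_le_of_weight_le (φ := fun x => min (φ x) N)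
    hp hR hWB hWR fun x => (abs_of_pos (hmin0 x)).trans_le (min_le_right _ _)
  refine (hreg.familyNorm_le_exp_mul (hφ.isTameWeight_min hN0) (one_le_two.trans hp) hR' hWR'
    (fun t₁ t₂ h0 h12 h2T x => hu.sub_eq_integral_evolutionRHS hreg hWu h0 h12 h2T x) ht).trans ?_
  have hmono : ∀ k, eLpNorm (fun x => W k 0 x * min (φ x) N) p volume ≤
      eLpNorm (fun x => W k 0 x * φ x) p volume := fun k => eLpNorm_mono fun x => by
    rw [norm_mul, norm_mul, Real.norm_of_nonneg (hmin0 x).le,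
      Real.norm_of_nonneg (hφ.moderate.pos x).le]
    gcongr
    exact min_le_left _ _
  have ht0 := ht.1
  gcongr
  · exact le_max_right _ _
  · exact add_le_add (add_le_add (hmono 0) (hmono 1)) (hmono 2)
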